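/- **Setting.** Let $\mathcal A$ (actions) be a measurable space and $\mathcal O$ (parameters) a standard Borel space; both may be infinite or continuous. A Bayesian bandit problem consists of a prior law $\mathbb P_\Theta$ of $\Theta\in\mathcal O$, a Markov kernel $(a,\theta)\mapsto \mathbb P_{R\mid a,\theta}$ giving the law of the real reward $R(a,\theta)$, with finite mean $r(a,\theta)=\mathbb E[R(a,\theta)]$, and a measurable map $\pi_\star:\mathcal O\to\mathcal A$ with $r(\pi_\star(\theta),\theta)=\max_{a} r(a,\theta)$ for all $\theta$. Put $A^\star=\pi_\star(\Theta)$. Thompson Sampling plays, in each round $t=1,\dots,T$, the action $A_t=\pi_\star(\hat\Theta_t)$, where, given the history $H^t$ of the previous action-reward pairs, $\hat\Theta_t$ is drawn from the posterior $\mathbb P_{\Theta\mid H^t}$ independently of $\Theta$, and receives a reward $R_t=R(A_t,\Theta)$ drawn from $\mathbb P_{R\mid A_t,\Theta}$. Its Bayesian regret is $\mathbb E[\mathrm{Regret}(T)]=\mathbb E\big[\sum_{t=1}^T (R(A^\star,\Theta)-R(A_t,\Theta))\big]$, where $r(A^\star,\Theta)$ and all $r(A_t,\Theta)$, $t\le T$,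 are assumed integrable. Write $\mathbb E_t,\mathbb P_t,\mathrm I_t$ for expectation, probability and mutual information conditioned on the value of $H^t$; entropies and informations are in nats. **Partition.** Let $\{\mathcal A_k\}_{k=1}^K$ be a finite measurable partition of $\mathcal A$ such that, for every $\theta\in\mathcal O$ and every $a'$ in the same cell as $a=\pi_\star(\theta)$, $r(a,\theta)-r(a',\theta)\le\varepsilon$. Let $A^\star_\varepsilon=k$ if and only if $A^\star\in\mathcal A_k$, and let $\mathrm H(A^\star_\varepsilon)$ be its Shannon entropy under the prior. **One-step compressed Thompson Sampling.** For each $t\le T$ let $\phi_t$ be a random function $\{1,\dots,K\}\to\mathcal A$ depending on $H^t$ such that, for almost every value of $H^t$ and every $k$ with $\mathbb P_t[A^\star\in\mathcal A_k]>0$, $\phi_t(k)$ equals $a_1$ with probability $q$ and $a_2$ with probability $1-q$, for some $a_1,a_2\in\mathcal A_k$ and $q\in[0,1]$ (depending on $H^t$ and $k$), where $r(a_1,\Theta)$ and $r(a_2,\Theta)$ are integrable under $\mathbb P_t$, and $$q f_t(a_1)+(1-q) f_t(a_2)\le\int f_t\,d\mathbb Q_{t,k},\qquad q g_t(a_1)+(1-q)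 g_t(a_2)\le\int g_t\,d\mathbb Q_{t,k},$$ with $f_t(a)=\mathbb E_t[R(a,\Theta)]$, $g_t(a)=\mathrm I_t(A^\star_\varepsilon;R(a,\Theta))$ and $\mathbb Q_{t,k}=\mathbb P_t[A^\star\in\cdot\mid A^\star\in\mathcal A_k]$. The random choices in $\phi_t$ are independent of everything else given $H^t$. Put $\tilde A^\star_t=\phi_t(A^\star_\varepsilon)$ and $\tilde A_{t,\varepsilon}=\phi_t(\hat A_{t,\varepsilon})$, where $\hat A_{t,\varepsilon}$ is the index of the cell that contains an action sampled from $\mathbb P_t[A^\star\in\cdot]$ independently of $\Theta$, and define the information ratio $$\tilde\Gamma_t=\frac{\mathbb E_t[R(\tilde A^\star_t,\Theta)-R(\tilde A_{t,\varepsilon},\Theta)]^2}{\mathrm I_t(A^\star_\varepsilon;\tilde A_{t,\varepsilon},R(\tilde A_{t,\varepsilon},\Theta))}\in[0,\infty],$$ with $0/0=0$ and $x/0=\infty$ for $x>0$. **Theorem.** If $\frac1T\sum_{t=1}^T\mathbb E[\tilde\Gamma_t]\le\tilde\Gamma$ for some real $\tilde\Gamma>0$, then $$\mathbb E[\mathrm{Regret}(T)]\le\sqrt{\tilde\Gamma\,T\,\mathrm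 H(A^\star_\varepsilon)}+\varepsilon T .$$ -/

import Mathlib

open MeasureTheory ProbabilityTheory InformationTheory
open scoped ENNReal

/-- A Bayesian bandit problem with (arbitrary) parameter space `O` and action space `A`: the prior
law of the parameter `Θ`, the conditional law `reward (a, θ)` of the reward `R(a, θ)`, and a
measurable choice `optAct` of an action maximizing the expected reward, for each parameter. -/
structure BayesianBandit (O A : Type*) [MeasurableSpace O] [MeasurableSpace A] where
  prior : Measure O
  isProbabilityMeasure_prior : IsProbabilityMeasure prior
  reward : Kernel (A × O) ℝ
  isMarkovKernel_reward : IsMarkovKernel reward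
  /-- The expected reward exists for every action and every parameter. -/
  integrable_reward : ∀ a θ, Integrable (fun x : ℝ => x) (reward (a, θ))
  optAct : O → A
  measurable_optAct : Measurable optAct
  optAct_isMax : ∀ θ a, ∫ x, x ∂reward (a, θ) ≤ ∫ x, x ∂reward (optAct θ, θ)

attribute [instance] BayesianBandit.isProbabilityMeasure_prior
  BayesianBandit.isMarkovKernel_reward

/-- Histories after `t` rounds: the list of the `t` action-reward pairs observed so far. -/
abbrev Hist (A : Type*) (t : ℕ) : Type _ := Fin t → A × ℝ

/-- A random choice between two points: `fst` with probability `q`, `snd` with probability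
`1 - q`. -/
structure TwoPoint (A : Type*) where
  fst : A
  snd : A
  q : ℝ
  q_nonneg : 0 ≤ q
  q_le_one : q ≤ 1

/-- The law `q δ_{fst} + (1 - q) δ_{snd}`. -/
noncomputable def TwoPoint.law {A : Type*} [MeasurableSpace A] (p : TwoPoint A) : Measure A :=
  ENNReal.ofReal p.q • Measure.dirac p.fst + ENNReal.ofReal (1 - p.q) • Measure.dirac p.snd

/-- Mutual information `I(X; Y)` (in nats) of a pair `(X, Y)` with joint law `μ`: the
Kullback-Leibler divergence of the joint law from the product of its marginals. -/
noncomputable def mutualInfo {X Y : Type*} [MeasurableSpace X] [MeasurableSpace Y]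
    (μ : Measure (X × Y)) : ℝ≥0∞ :=
  klDiv μ (μ.fst.prod μ.snd)

theorem measurable_histSnoc {O A : Type*} [MeasurableSpace O] [MeasurableSpace A] (t : ℕ) :
    Measurable (fun p : (O × Hist A t) × (A × ℝ) =>
      ((p.1.1, Fin.snoc (α := fun _ => A × ℝ) p.1.2 p.2) : O × Hist A (t + 1))) := by
  refine Measurable.prodMk (by fun_prop) (measurable_pi_iff.mpr fun i => ?_)
  refine Fin.lastCases ?_ (fun j => ?_) i
  · simpa using measurable_snd
  · simp only [Fin.snoc_castSucc]
    fun_prop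

namespace BayesianBandit

variable {O A : Type*} [MeasurableSpace O] [MeasurableSpace A]

/-- The expected reward `E[R(a, θ)]`. -/
noncomputable def mean (B : BayesianBandit O A) (a : A) (θ : O) : ℝ :=
  ∫ x, x ∂B.reward (a, θ)

/-- One round of Thompson Sampling, when `μ` is the joint law of `(Θ, H)` with `H` the current
history: given `(Θ, H) = (θ, h)`, a parameter is drawn from the posterior law of `Θ` given `H = h`,
its optimal action `a` is played, and a reward is drawn from `reward (a, θ)`. -/
noncomputable def tsStep [StandardBorelSpace O] [Nonempty O] (B : BayesianBandit O A) {t : ℕ}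
    (μ : Measure (O × Hist A t)) [IsFiniteMeasure μ] : Kernel (O × Hist A t) (A × ℝ) :=
  (((condDistrib Prod.fst Prod.snd μ).map B.optAct).comap Prod.snd measurable_snd) ⊗ₖ
    (B.reward.comap (fun x : (O × Hist A t) × A => (x.2, x.1.1)) (by fun_prop))

instance [StandardBorelSpace O] [Nonempty O] (B : BayesianBandit O A) {t : ℕ}
    (μ : Measure (O × Hist A t)) [IsFiniteMeasure μ] : IsMarkovKernel (B.tsStep μ) := by
  have := Kernel.IsMarkovKernel.map (condDistrib Prod.fst Prod.snd μ) B.measurable_optAct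
  unfold tsStep
  infer_instance

/-- The joint law of the parameter `Θ` and of the history of the first `t` rounds, when the actions
are selected by Thompson Sampling. -/
noncomputable def tsLaw [StandardBorelSpace O] [Nonempty O] (B : BayesianBandit O A) :
    (t : ℕ) → ProbabilityMeasure (O × Hist A t)
  | 0 => ⟨B.prior.map (fun θ => (θ, Fin.elim0)),
      Measure.isProbabilityMeasure_map (by fun_prop)⟩
  | t + 1 => ⟨((B.tsLaw t : Measure (O × Hist A t)) ⊗ₘ B.tsStep (B.tsLaw t)).map
        (fun p => (p.1.1, Fin.snoc (α := fun _ => A × ℝ) p.1.2 p.2)),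
      Measure.isProbabilityMeasure_map (measurable_histSnoc t).aemeasurable⟩

/-- The law of the history of the first `t` rounds under Thompson Sampling. -/
noncomputable def histLaw [StandardBorelSpace O] [Nonempty O] (B : BayesianBandit O A) (t : ℕ) :
    Measure (Hist A t) :=
  (B.tsLaw t : Measure (O × Hist A t)).snd

/-- The posterior law of `Θ` given the history of the first `t` rounds. -/
noncomputable def posterior [StandardBorelSpace O] [Nonempty O] (B : BayesianBandit O A) (t : ℕ) :
    Kernel (Hist A t) O :=
  condDistrib Prod.fst Prod.snd (B.tsLaw t : Measure (O × Hist A t))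

/-- All the expected rewards that enter the regret over `T` rounds are finite. -/
def IntegrableRewards [StandardBorelSpace O] [Nonempty O] (B : BayesianBandit O A) (T : ℕ) :
    Prop :=
  Integrable (fun θ => B.mean (B.optAct θ) θ) B.prior ∧
    ∀ t : Fin T, Integrable (fun p : O × Hist A T => B.mean (p.2 t).1 p.1)
      (B.tsLaw T : Measure (O × Hist A T))

/-- The Bayesian regret of Thompson Sampling over `T` rounds,
`E[∑ₜ (R(A⋆, Θ) - R(Aₜ, Θ))]`; the expectation over the reward distribution is taken inside. -/
noncomputable def regret [StandardBorelSpace O] [Nonempty O] (B : BayesianBandit O A) (T : ℕ) :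
    ℝ :=
  ∫ p : O × Hist A T, ∑ t : Fin T, (B.mean (B.optAct p.1) p.1 - B.mean (p.2 t).1 p.1)
    ∂(B.tsLaw T : Measure (O × Hist A T))

/-! A partition of the action space into `K` measurable cells is encoded by the map
`cell : A → Fin K` that sends an action to the index of its cell; the statistic is
`A⋆_ε = cell A⋆`, where `A⋆ = optAct Θ`. -/

/-- For every action `a = optAct θ` and every `a'` in the cell of `a`,
`E[R(a, θ) - R(a', θ)] ≤ ε`. -/
def IsEpsPartition (B : BayesianBandit O A) {K : ℕ} (cell : A → Fin K) (ε : ℝ) : Prop :=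
  Measurable cell ∧
    ∀ θ a', cell a' = cell (B.optAct θ) → B.mean (B.optAct θ) θ - B.mean a' θ ≤ ε

/-- The Shannon entropy (in nats) `H(A⋆_ε)` under the prior. -/
noncomputable def entropy (B : BayesianBandit O A) {K : ℕ} (cell : A → Fin K) : ℝ :=
  ∑ k, Real.negMulLog (B.prior.real {θ | cell (B.optAct θ) = k})

/-- When `Θ` has law `ρ`: the mutual information `I(A⋆_ε; R(a, Θ))` for a fixed action `a`. -/
noncomputable def rewardInfo (B : BayesianBandit O A) {K : ℕ} (cell : A → Fin K) (ρ : Measure O)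
    (a : A) : ℝ≥0∞ :=
  mutualInfo ((ρ ⊗ₘ B.reward.comap (fun θ => (a, θ)) (by fun_prop)).map
    (fun p : O × ℝ => (cell (B.optAct p.1), p.2)))

/-- When `Θ` has law `ρ`: the mutual information `I(A⋆_ε; X, R(X, Θ))` for a random action `X`
with law `α`, independent of `Θ`. -/
noncomputable def actionRewardInfo (B : BayesianBandit O A) {K : ℕ} (cell : A → Fin K)
    (ρ : Measure O) (α : Measure A) : ℝ≥0∞ :=
  mutualInfo (((α.prod ρ) ⊗ₘ B.reward).map
    (fun p : (A × O) × ℝ => (cell (B.optAct p.1.2), (p.1.1, p.2))))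

variable [StandardBorelSpace O] [Nonempty O]

/-- The posterior law of `A⋆` given the history `h` and given that `A⋆` lies in the `k`-th cell. -/
noncomputable def cellPosterior (B : BayesianBandit O A) {K : ℕ} (cell : A → Fin K) (t : ℕ)
    (h : Hist A t) (k : Fin K) : Measure A :=
  ((B.posterior t h).map B.optAct)[|cell ⁻¹' {k}]

/-- `E[R(a, Θ) | h]`. -/
noncomputable def condMean (B : BayesianBandit O A) (t : ℕ) (h : Hist A t) (a : A) : ℝ :=
  ∫ θ, B.mean a θ ∂B.posterior t h

/-- The random functions `φ h : Fin K → A` (one for each history `h`) define a one-step compressed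
Thompson Sampling: for almost every history and every cell of positive posterior probability,
`φ h k` is a random choice between two actions of the `k`-th cell, such that on average over this
choice neither the conditional expected reward `f a = E[R(a, Θ) | h]` nor the information
`g a = I(A⋆_ε; R(a, Θ) | h)` exceeds its average over the posterior law of `A⋆` in that cell. -/
def IsCompressed (B : BayesianBandit O A) {K : ℕ} (cell : A → Fin K) (t : ℕ)
    (φ : Hist A t → Fin K → TwoPoint A) : Prop :=
  ∀ᵐ h ∂B.histLaw t, ∀ k, B.posterior t h {θ | cell (B.optAct θ) = k} ≠ 0 →
    cell (φ h k).fst = k ∧ cell (φ h k).snd = k ∧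
    Integrable (fun θ => B.mean (φ h k).fst θ) (B.posterior t h) ∧
    Integrable (fun θ => B.mean (φ h k).snd θ) (B.posterior t h) ∧
    (φ h k).q * B.condMean t h (φ h k).fst + (1 - (φ h k).q) * B.condMean t h (φ h k).snd
      ≤ ∫ a, B.condMean t h a ∂B.cellPosterior cell t h k ∧
    ENNReal.ofReal (φ h k).q * B.rewardInfo cell (B.posterior t h) (φ h k).fst
        + ENNReal.ofReal (1 - (φ h k).q) * B.rewardInfo cell (B.posterior t h) (φ h k).snd
      ≤ ∫⁻ a, B.rewardInfo cell (B.posterior t h) a ∂B.cellPosterior cell t h k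

/-- The law, given the history `h`, of `φ h (cell Âₜ)` where `Âₜ` is the action sampled by Thompson
Sampling. -/
noncomputable def compressedActionLaw (B : BayesianBandit O A) {K : ℕ} (cell : A → Fin K) (t : ℕ)
    (φ : Hist A t → Fin K → TwoPoint A) (h : Hist A t) : Measure A :=
  ((B.posterior t h).map (fun θ => cell (B.optAct θ))).bind (fun k => (φ h k).law)

/-- The conditional expected one-step regret `E[R(Ã⋆, Θ) - R(Ã, Θ) | h]`, where `Ã⋆ = φ h (A⋆_ε)`
and `Ã = φ h (cell Âₜ)`; the random choices in `φ h` and `Âₜ` are independent of `Θ` given `h`. -/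
noncomputable def compressedRegret (B : BayesianBandit O A) {K : ℕ} (cell : A → Fin K) (t : ℕ)
    (φ : Hist A t → Fin K → TwoPoint A) (h : Hist A t) : ℝ :=
  ∫ θ, ∫ a, B.mean a θ ∂(φ h (cell (B.optAct θ))).law ∂B.posterior t h
    - ∫ θ, ∫ a, B.mean a θ ∂B.compressedActionLaw cell t φ h ∂B.posterior t h

/-- The one-step compressed Thompson Sampling information ratio
`E[R(Ã⋆, Θ) - R(Ã, Θ) | h]² / I(A⋆_ε; Ã, R(Ã, Θ) | h)`, with values in `[0, ∞]`
(`0 / 0 = 0` and `x / 0 = ∞` for `x > 0`). -/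
noncomputable def infoRatio (B : BayesianBandit O A) {K : ℕ} (cell : A → Fin K) (t : ℕ)
    (φ : Hist A t → Fin K → TwoPoint A) (h : Hist A t) : ℝ≥0∞ :=
  ENNReal.ofReal (B.compressedRegret cell t φ h ^ 2) /
    B.actionRewardInfo cell (B.posterior t h) (B.compressedActionLaw cell t φ h)

end BayesianBandit

/-! Fix a history. Replacing the optimal action by points of its own cell costs at most ε, and by
the choice of φ the compressed action earns on average no more than the Thompson action. So the
one-step regret is at most the compressed one plus ε (`ae_stepRegret_le`).

The square of the compressed regret is governed by the information ratio times the information that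
the compressed action and its reward give about the optimal cell. Mutual information is convex in
the channel (`mutualInfo_sum_le`), so this information is at most an average of the informations of
fixed actions, and by the choice of φ at most their average over the Thompson action
(`ae_actionRewardInfo_le`). The latter is bounded by the expected drop of the entropy of the optimal
cell in one round: `mutualInfo_add_lintegral_finEntropy_le` applies because the updated posterior is
a conditional law given the new reward (`ae_obsKernel_disintegration`). The expected drops
telescope, so their total is at most the prior entropy (`sum_lintegral_infoGain_add`).

Cauchy-Schwarz is replaced by 2x ≤ c x²/d + d/c, with one constant c for all rounds that is
optimized at the very end. This works in [0, ∞] and needs no measurability of the information ratio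
in the history; the entropy drop, which is measurable, is the term that allows the integrals to be
split. -/

/-! ### Subadditivity of the Kullback-Leibler divergence -/

theorem klDiv_withDensity_left {α : Type*} [MeasurableSpace α] (ν : Measure α) [IsFiniteMeasure ν]
    {f : α → ℝ≥0∞} (hf : Measurable f) [IsFiniteMeasure (ν.withDensity f)] :
    klDiv (ν.withDensity f) ν = ∫⁻ x, ENNReal.ofReal (klFun (f x).toReal) ∂ν := by
  rw [klDiv_eq_lintegral_klFun_of_ac (withDensity_absolutelyContinuous ν f)]
  refine lintegral_congr_ae ?_
  filter_upwards [Measure.rnDeriv_withDensity ν hf] with x hx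
  rw [hx]

/-- The Kullback-Leibler divergence is subadditive. -/
theorem klDiv_sum_le {ι α : Type*} [Fintype ι] [MeasurableSpace α] (μ ν : ι → Measure α)
    [∀ i, IsFiniteMeasure (μ i)] [∀ i, IsFiniteMeasure (ν i)] :
    klDiv (∑ i, μ i) (∑ i, ν i) ≤ ∑ i, klDiv (μ i) (ν i) := by
  by_cases hac : ∀ i, μ i ≪ ν i
  swap
  · push Not at hac
    obtain ⟨i, hi⟩ := hac
    have : ∑ i, klDiv (μ i) (ν i) = ∞ :=
      ENNReal.sum_eq_top.2 ⟨i, Finset.mem_univ i, klDiv_of_not_ac hi⟩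
    simp [this]
  let _ : MeasurableSpace ι := ⊤
  have : DiscreteMeasurableSpace ι := ⟨fun _ => trivial⟩
  have hmk (i : ι) : Measurable (fun x : α => (i, x)) := by fun_prop
  -- Tagging each measure with its index makes the summands mutually singular, so that divergences
  -- add up exactly; forgetting the tag is a map, and data processing gives the inequality.
  have key (ρ : ι → Measure α) : (∑ i, (ρ i).map (fun x => (i, x))).map Prod.snd = ∑ i, ρ i := by
    refine Measure.ext_of_lintegral _ fun g hg => ?_
    rw [lintegral_map hg measurable_snd, lintegral_finsetSum_measure,
      lintegral_finsetSum_measure]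
    exact Finset.sum_congr rfl fun i _ => lintegral_map (hg.comp measurable_snd) (hmk i)
  set f : ι × α → ℝ≥0∞ := fun p => (μ p.1).rnDeriv (ν p.1) p.2 with hf_def
  have hf : Measurable f := measurable_from_prod_countable_right fun i =>
    Measure.measurable_rnDeriv (μ i) (ν i)
  have hdens : (∑ i, (ν i).map (fun x => (i, x))).withDensity f =
      ∑ i, (μ i).map (fun x => (i, x)) := by
    refine Measure.ext_of_lintegral _ fun g hg => ?_
    rw [lintegral_withDensity_eq_lintegral_mul _ hf hg, lintegral_finsetSum_measure,
      lintegral_finsetSum_measure]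
    refine Finset.sum_congr rfl fun i _ => ?_
    rw [lintegral_map (hf.mul hg) (hmk i), lintegral_map hg (hmk i)]
    exact lintegral_rnDeriv_mul (hac i) (hg.comp (hmk i)).aemeasurable
  have hwd : IsFiniteMeasure ((∑ i, (ν i).map (fun x => (i, x))).withDensity f) := by
    rw [hdens]; infer_instance
  calc klDiv (∑ i, μ i) (∑ i, ν i)
      ≤ klDiv (∑ i, (μ i).map (fun x => (i, x))) (∑ i, (ν i).map (fun x => (i, x))) := by
        rw [← key μ, ← key ν]
        exact klDiv_map_le _ _ measurable_snd
    _ = ∑ i, klDiv (μ i) (ν i) := by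
        rw [← hdens, @klDiv_withDensity_left _ _ (∑ i, (ν i).map (fun x => (i, x)))
          inferInstance f hf hwd,
          lintegral_finsetSum_measure]
        refine Finset.sum_congr rfl fun i _ => ?_
        rw [lintegral_map (by fun_prop) (hmk i), klDiv_eq_lintegral_klFun_of_ac (hac i)]

/-- The Shannon entropy (in nats) of a measure on a finite space. -/
noncomputable def finEntropy {K : ℕ} (p : Measure (Fin K)) : ℝ :=
  ∑ k, Real.negMulLog (p.real {k})

theorem finEntropy_nonneg {K : ℕ} (p : Measure (Fin K)) [IsProbabilityMeasure p] :
    0 ≤ finEntropy p :=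
  Finset.sum_nonneg fun _ _ => Real.negMulLog_nonneg measureReal_nonneg measureReal_le_one

theorem measurable_finEntropy {K : ℕ} {Y : Type*} [MeasurableSpace Y] (η : Kernel Y (Fin K)) :
    Measurable fun y => finEntropy (η y) := by
  refine Finset.measurable_sum _ fun k _ => Real.continuous_negMulLog.measurable.comp ?_
  exact (η.measurable_coe (measurableSet_singleton k)).ennreal_toReal

/-! ### Mutual information with a finite-valued variable -/

section FiniteMarginal

variable {K : ℕ} {Y : Type*} [MeasurableSpace Y] {μ : Measure (Fin K × Y)} {η : Kernel Y (Fin K)}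

theorem measurable_kernel_singleton (η : Kernel Y (Fin K)) (k : Fin K) :
    Measurable fun y => η y {k} := η.measurable_coe (measurableSet_singleton k)

theorem lintegral_eq_of_disintegration [IsFiniteMeasure μ] [IsMarkovKernel η]
    (h : μ.snd ⊗ₘ η = μ.map Prod.swap) {g : Fin K × Y → ℝ≥0∞} (hg : Measurable g) :
    ∫⁻ x, g x ∂μ = ∫⁻ y, ∑ k, g (k, y) * η y {k} ∂μ.snd := by
  have h1 : ∫⁻ x, g x ∂μ = ∫⁻ x, g x.swap ∂(μ.map Prod.swap) := by
    rw [lintegral_map (by fun_prop) measurable_swap]; simp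
  rw [h1, ← h, Measure.lintegral_compProd (by fun_prop)]
  simp [lintegral_fintype]

theorem lintegral_disintegration_singleton [IsFiniteMeasure μ] [IsMarkovKernel η]
    (h : μ.snd ⊗ₘ η = μ.map Prod.swap) (k : Fin K) :
    ∫⁻ y, η y {k} ∂μ.snd = μ.fst {k} := by
  have hm : Measurable (({k} : Set (Fin K)).indicator (1 : Fin K → ℝ≥0∞)) :=
    measurable_one.indicator (measurableSet_singleton k)
  have h1 := lintegral_eq_of_disintegration h (hm.comp measurable_fst)
  have h2 : ∫⁻ x, (({k} : Set (Fin K)).indicator 1 ∘ Prod.fst) x ∂μ = μ.fst {k} := by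
    rw [Measure.fst, ← lintegral_indicator_one (measurableSet_singleton k),
      lintegral_map hm measurable_fst]
    rfl
  rw [← h2, h1]
  refine lintegral_congr fun y => ?_
  rw [Finset.sum_eq_single k] <;> simp +contextual

theorem ae_disintegration_eq_zero [IsFiniteMeasure μ] [IsMarkovKernel η]
    (h : μ.snd ⊗ₘ η = μ.map Prod.swap) :
    ∀ᵐ y ∂μ.snd, ∀ k, μ.fst {k} = 0 → η y {k} = 0 := by
  refine ae_all_iff.2 fun k => ?_
  by_cases hk : μ.fst {k} = 0
  · rw [← lintegral_disintegration_singleton h k,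
      lintegral_eq_zero_iff (measurable_kernel_singleton η k)] at hk
    filter_upwards [hk] with y hy _ using hy
  · exact Filter.Eventually.of_forall fun y hy => absurd hy hk

/-- The density of the joint law with respect to the product of its marginals is the ratio of
posterior to prior probability. Points of prior mass zero do no harm, since almost every posterior
also gives them mass zero. -/
theorem mutualInfo_eq_lintegral_klFun [IsProbabilityMeasure μ] [IsMarkovKernel η]
    (h : μ.snd ⊗ₘ η = μ.map Prod.swap) :
    mutualInfo μ = ∫⁻ y, ∑ k,
      ENNReal.ofReal (klFun (η y {k} / μ.fst {k}).toReal) * μ.fst {k} ∂μ.snd := by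
  have hprod {g : Fin K × Y → ℝ≥0∞} (hg : Measurable g) :
      ∫⁻ x, g x ∂(μ.fst.prod μ.snd) = ∫⁻ y, ∑ k, g (k, y) * μ.fst {k} ∂μ.snd := by
    rw [lintegral_prod_symm _ hg.aemeasurable]
    simp only [lintegral_fintype]
  set f : Fin K × Y → ℝ≥0∞ := fun x => η x.2 {x.1} / μ.fst {x.1} with hf_def
  have hf : Measurable f := measurable_from_prod_countable_right fun k =>
    (measurable_kernel_singleton η k).div_const (μ.fst {k})
  have hdens : (μ.fst.prod μ.snd).withDensity f = μ := by
    refine Measure.ext_of_lintegral _ fun g hg => ?_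
    rw [lintegral_withDensity_eq_lintegral_mul _ hf hg, hprod (hf.mul hg),
      lintegral_eq_of_disintegration h hg]
    refine lintegral_congr_ae ?_
    filter_upwards [ae_disintegration_eq_zero h] with y hy
    refine Finset.sum_congr rfl fun k _ => ?_
    by_cases hk : μ.fst {k} = 0
    · rw [hk, hy k hk, mul_zero, mul_zero]
    · simp only [hf_def, Pi.mul_apply]
      rw [mul_right_comm, ENNReal.div_mul_cancel hk (measure_ne_top _ _), mul_comm]
  have : IsFiniteMeasure ((μ.fst.prod μ.snd).withDensity f) := by rw [hdens]; infer_instance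
  have h1 := klDiv_withDensity_left (μ.fst.prod μ.snd) hf
  rw [hdens, hprod (by fun_prop)] at h1
  exact h1

/-- Pointwise form of I = H(prior) - E[H(posterior)], with p the prior and x the posterior weight.
The correction p - x disappears on summation, both weights having total mass one. -/
theorem klFun_div_mul_add_negMulLog {p x : ℝ} (h : p = 0 → x = 0) :
    klFun (x / p) * p + Real.negMulLog x = -Real.log p * x + p - x := by
  by_cases hp : p = 0
  · simp [hp, h hp]
  by_cases hx : x = 0
  · simp [hx, klFun_apply]
  rw [klFun_apply, Real.negMulLog, Real.log_div hx hp]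
  field_simp
  ring

/-- Mutual information is at most prior entropy minus expected posterior entropy. -/
theorem mutualInfo_add_lintegral_finEntropy_le [IsProbabilityMeasure μ] [IsMarkovKernel η]
    (h : μ.snd ⊗ₘ η = μ.map Prod.swap) :
    mutualInfo μ + ∫⁻ y, ENNReal.ofReal (finEntropy (η y)) ∂μ.snd
      ≤ ENNReal.ofReal (finEntropy μ.fst) := by
  have hηm := measurable_kernel_singleton η
  have hlog (k : Fin K) : 0 ≤ -Real.log (μ.fst.real {k}) :=
    neg_nonneg.2 (Real.log_nonpos measureReal_nonneg measureReal_le_one)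
  rw [mutualInfo_eq_lintegral_klFun h,
    ← lintegral_add_right _ (measurable_finEntropy η).ennreal_ofReal]
  -- Equality holds: both sides are the expected cross entropy of the posterior relative to the
  -- prior, and the posterior averages to the prior.
  refine le_of_eq ?_
  calc ∫⁻ y, (∑ k, ENNReal.ofReal (klFun (η y {k} / μ.fst {k}).toReal) * μ.fst {k}
        + ENNReal.ofReal (finEntropy (η y))) ∂μ.snd
      = ∫⁻ y, ∑ k, ENNReal.ofReal (-Real.log (μ.fst.real {k})) * η y {k} ∂μ.snd := by
        refine lintegral_congr_ae ?_
        filter_upwards [ae_disintegration_eq_zero h] with y hy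
        have hsum (p : Measure (Fin K)) [IsProbabilityMeasure p] : ∑ k, p.real {k} = 1 := by
          simp
        have hkn (k : Fin K) : 0 ≤ klFun ((η y).real {k} / μ.fst.real {k}) :=
          klFun_nonneg (div_nonneg measureReal_nonneg measureReal_nonneg)
        have hz (k : Fin K) (hk : μ.fst.real {k} = 0) : (η y).real {k} = 0 := by
          rw [measureReal_eq_zero_iff] at hk ⊢
          exact hy k hk
        calc _ = ENNReal.ofReal (∑ k, (klFun ((η y).real {k} / μ.fst.real {k}) * μ.fst.real {k}
                + Real.negMulLog ((η y).real {k}))) := by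
              rw [Finset.sum_add_distrib, ← finEntropy, ENNReal.ofReal_add
                (Finset.sum_nonneg fun k _ => mul_nonneg (hkn k) measureReal_nonneg)
                (finEntropy_nonneg (η y)), ENNReal.ofReal_sum_of_nonneg
                fun k _ => mul_nonneg (hkn k) measureReal_nonneg]
              congr 1
              refine Finset.sum_congr rfl fun k _ => ?_
              rw [ENNReal.ofReal_mul (hkn k), ofReal_measureReal, ENNReal.toReal_div]
              rfl
          _ = ENNReal.ofReal (∑ k, -Real.log (μ.fst.real {k}) * (η y).real {k}) := by
              rw [Finset.sum_congr rfl fun k _ => klFun_div_mul_add_negMulLog (hz k),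
                Finset.sum_sub_distrib, Finset.sum_add_distrib, hsum, hsum, add_sub_cancel_right]
          _ = _ := by
              rw [ENNReal.ofReal_sum_of_nonneg fun k _ => mul_nonneg (hlog k) measureReal_nonneg]
              refine Finset.sum_congr rfl fun k _ => ?_
              rw [ENNReal.ofReal_mul (hlog k), ofReal_measureReal]
    _ = ∑ k, ENNReal.ofReal (-Real.log (μ.fst.real {k})) * μ.fst {k} := by
        rw [lintegral_finsetSum _ fun k _ => (hηm k).const_mul _]
        refine Finset.sum_congr rfl fun k _ => ?_
        rw [lintegral_const_mul _ (hηm k), lintegral_disintegration_singleton h]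
    _ = ENNReal.ofReal (finEntropy μ.fst) := by
        rw [finEntropy, ENNReal.ofReal_sum_of_nonneg fun k _ =>
          Real.negMulLog_nonneg measureReal_nonneg measureReal_le_one]
        refine Finset.sum_congr rfl fun k _ => ?_
        rw [Real.negMulLog, neg_mul_comm, ENNReal.ofReal_mul measureReal_nonneg, ofReal_measureReal,
          mul_comm]

end FiniteMarginal

/-! ### One round of Thompson Sampling and the posterior update -/

namespace BayesianBandit

variable {O A : Type*} [MeasurableSpace O] [MeasurableSpace A] [StandardBorelSpace O] [Nonempty O]

instance (B : BayesianBandit O A) (t : ℕ) : IsMarkovKernel (B.posterior t) := by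
  unfold posterior; infer_instance

instance (B : BayesianBandit O A) (t : ℕ) : IsProbabilityMeasure (B.histLaw t) := by
  unfold histLaw; infer_instance

/-- The law, given the history, of the action selected by Thompson Sampling. -/
noncomputable def actionLaw (B : BayesianBandit O A) (t : ℕ) : Kernel (Hist A t) A :=
  (B.posterior t).map B.optAct

instance (B : BayesianBandit O A) (t : ℕ) : IsMarkovKernel (B.actionLaw t) :=
  Kernel.IsMarkovKernel.map _ B.measurable_optAct

theorem actionLaw_apply (B : BayesianBandit O A) (t : ℕ) (h : Hist A t) :
    B.actionLaw t h = (B.posterior t h).map B.optAct :=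
  Kernel.map_apply _ B.measurable_optAct _

theorem measurable_histSnoc' (t : ℕ) :
    Measurable fun p : (Hist A t × A) × ℝ =>
      (Fin.snoc (α := fun _ => A × ℝ) p.1.1 (p.1.2, p.2) : Hist A (t + 1)) := by
  refine measurable_pi_iff.mpr fun i => ?_
  refine Fin.lastCases ?_ (fun j => ?_) i
  · simp only [Fin.snoc_last]
    fun_prop
  · simp only [Fin.snoc_castSucc]
    fun_prop

theorem map_swap_tsLaw (B : BayesianBandit O A) (t : ℕ) :
    (B.tsLaw t : Measure (O × Hist A t)).map Prod.swap = B.histLaw t ⊗ₘ B.posterior t :=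
  (compProd_map_condDistrib (μ := (B.tsLaw t : Measure (O × Hist A t))) (X := Prod.snd)
    measurable_fst.aemeasurable).symm

theorem lintegral_tsLaw (B : BayesianBandit O A) (t : ℕ) {F : O × Hist A t → ℝ≥0∞}
    (hF : Measurable F) :
    ∫⁻ p, F p ∂(B.tsLaw t : Measure (O × Hist A t)) =
      ∫⁻ h, ∫⁻ θ, F (θ, h) ∂B.posterior t h ∂B.histLaw t := by
  rw [← Measure.lintegral_compProd (f := fun p => F (p.2, p.1)) (by fun_prop),
    ← map_swap_tsLaw, lintegral_map (by fun_prop) measurable_swap]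
  rfl

theorem lintegral_histLaw (B : BayesianBandit O A) (t : ℕ) {F : Hist A t → ℝ≥0∞}
    (hF : Measurable F) :
    ∫⁻ h, F h ∂B.histLaw t = ∫⁻ p, F p.2 ∂(B.tsLaw t : Measure (O × Hist A t)) :=
  lintegral_map hF measurable_snd

/-- One round of Thompson Sampling: given the history, the action and the parameter are
independent. -/
theorem lintegral_tsLaw_succ (B : BayesianBandit O A) (t : ℕ) {F : O × Hist A (t + 1) → ℝ≥0∞}
    (hF : Measurable F) :
    ∫⁻ p, F p ∂(B.tsLaw (t + 1) : Measure (O × Hist A (t + 1))) =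
      ∫⁻ h, ∫⁻ a, ∫⁻ θ, ∫⁻ r, F (θ, Fin.snoc (α := fun _ => A × ℝ) h (a, r)) ∂B.reward (a, θ)
        ∂B.posterior t h ∂B.actionLaw t h ∂B.histLaw t := by
  have hG : Measurable fun p : (O × Hist A t) × (A × ℝ) =>
      F (p.1.1, Fin.snoc (α := fun _ => A × ℝ) p.1.2 p.2) := hF.comp (measurable_histSnoc t)
  have h1 : ∫⁻ p, F p ∂(B.tsLaw (t + 1) : Measure (O × Hist A (t + 1))) =
      ∫⁻ p, F (p.1.1, Fin.snoc (α := fun _ => A × ℝ) p.1.2 p.2)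
        ∂((B.tsLaw t : Measure (O × Hist A t)) ⊗ₘ B.tsStep (B.tsLaw t)) :=
    lintegral_map hF (measurable_histSnoc t)
  rw [h1, Measure.lintegral_compProd hG, lintegral_tsLaw B t hG.lintegral_kernel_prod_right']
  refine lintegral_congr fun h => ?_
  have := Kernel.IsMarkovKernel.map (condDistrib Prod.fst Prod.snd
    (B.tsLaw t : Measure (O × Hist A t))) B.measurable_optAct
  have h2 (θ : O) : ∫⁻ b, F (θ, Fin.snoc (α := fun _ => A × ℝ) h b) ∂B.tsStep (B.tsLaw t) (θ, h) =
      ∫⁻ a, ∫⁻ r, F (θ, Fin.snoc (α := fun _ => A × ℝ) h (a, r)) ∂B.reward (a, θ)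
        ∂B.actionLaw t h := by
    have hGb : Measurable fun b : A × ℝ => F (θ, Fin.snoc (α := fun _ => A × ℝ) h b) :=
      hG.comp (measurable_prodMk_left (x := (θ, h)))
    rw [tsStep, Kernel.lintegral_compProd _ _ _ hGb]
    rfl
  simp only [h2]
  -- The action law depends on the history but not on θ, so Tonelli exchanges the two draws.
  refine lintegral_lintegral_swap (Measurable.aemeasurable ?_)
  have h3 : Measurable fun q : (O × A) × ℝ =>
      F (q.1.1, Fin.snoc (α := fun _ => A × ℝ) h (q.1.2, q.2)) :=
    hG.comp (by fun_prop : Measurable fun q : (O × A) × ℝ => ((q.1.1, h), (q.1.2, q.2)))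
  exact h3.lintegral_kernel_prod_right' (κ := B.reward.comap Prod.swap measurable_swap)

variable {K : ℕ} {cell : A → Fin K}

/-- The joint law of the cell of the optimal action and of the reward of the action `a`, given the
history `h`, as a kernel in `(h, a)`. -/
noncomputable def obsKernel (B : BayesianBandit O A) (cell : A → Fin K) (t : ℕ) :
    Kernel (Hist A t × A) (Fin K × ℝ) :=
  (((B.posterior t).comap Prod.fst measurable_fst) ⊗ₖ
    (B.reward.comap (fun p : (Hist A t × A) × O => (p.1.2, p.2)) (by fun_prop))).map
    (fun p => (cell (B.optAct p.1), p.2))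

omit [StandardBorelSpace O] [Nonempty O] in
theorem measurable_cell_reward (B : BayesianBandit O A) (hcell : Measurable cell) :
    Measurable fun p : O × ℝ => (cell (B.optAct p.1), p.2) :=
  (hcell.comp (B.measurable_optAct.comp measurable_fst)).prodMk measurable_snd

theorem isMarkovKernel_obsKernel (B : BayesianBandit O A) (hcell : Measurable cell) (t : ℕ) :
    IsMarkovKernel (B.obsKernel cell t) :=
  Kernel.IsMarkovKernel.map _ (B.measurable_cell_reward hcell)

theorem lintegral_obsKernel (B : BayesianBandit O A) (hcell : Measurable cell) (t : ℕ)
    (p : Hist A t × A) {F : Fin K × ℝ → ℝ≥0∞} (hF : Measurable F) :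
    ∫⁻ x, F x ∂B.obsKernel cell t p =
      ∫⁻ θ, ∫⁻ r, F (cell (B.optAct θ), r) ∂B.reward (p.2, θ) ∂B.posterior t p.1 := by
  have hm := B.measurable_cell_reward hcell
  have hFm : Measurable fun p : O × ℝ => F (cell (B.optAct p.1), p.2) := hF.comp hm
  rw [obsKernel, Kernel.lintegral_map _ hm _ hF, Kernel.lintegral_compProd _ _ _ hFm]
  rfl

/-- The kernel form provides joint measurability in the history and the action, which the
disintegration argument needs. -/
theorem rewardInfo_posterior (B : BayesianBandit O A) (hcell : Measurable cell) (t : ℕ)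
    (h : Hist A t) (a : A) :
    B.rewardInfo cell (B.posterior t h) a = mutualInfo (B.obsKernel cell t (h, a)) := by
  have hm := B.measurable_cell_reward hcell
  rw [rewardInfo]
  congr 1
  refine Measure.ext_of_lintegral _ fun F hF => ?_
  have hFm : Measurable fun p : O × ℝ => F (cell (B.optAct p.1), p.2) := hF.comp hm
  rw [lintegral_obsKernel B hcell t _ hF, lintegral_map hF hm, Measure.lintegral_compProd hFm]
  rfl

/-- The posterior law of the cell of the optimal action. -/
noncomputable def cellKernel (B : BayesianBandit O A) (cell : A → Fin K) (t : ℕ) :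
    Kernel (Hist A t) (Fin K) :=
  (B.posterior t).map (fun θ => cell (B.optAct θ))

theorem isMarkovKernel_cellKernel (B : BayesianBandit O A) (hcell : Measurable cell) (t : ℕ) :
    IsMarkovKernel (B.cellKernel cell t) :=
  Kernel.IsMarkovKernel.map _ (hcell.comp B.measurable_optAct)

theorem lintegral_cellKernel (B : BayesianBandit O A) (hcell : Measurable cell) (t : ℕ)
    (h : Hist A t) (F : Fin K → ℝ≥0∞) :
    ∫⁻ k, F k ∂B.cellKernel cell t h = ∫⁻ θ, F (cell (B.optAct θ)) ∂B.posterior t h :=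
  Kernel.lintegral_map _ (hcell.comp B.measurable_optAct) _ (measurable_of_countable F)

theorem fst_obsKernel (B : BayesianBandit O A) (hcell : Measurable cell) (t : ℕ)
    (p : Hist A t × A) : (B.obsKernel cell t p).fst = B.cellKernel cell t p.1 := by
  refine Measure.ext_of_lintegral _ fun F hF => ?_
  rw [Measure.fst, lintegral_map hF measurable_fst,
    lintegral_obsKernel B hcell t p (F := fun x => F x.1) (by fun_prop),
    lintegral_cellKernel B hcell]
  simp

/-- The posterior law of the cell of the optimal action after one more round. -/
noncomputable def nextCellKernel (B : BayesianBandit O A) (cell : A → Fin K) (t : ℕ) :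
    Kernel ((Hist A t × A) × ℝ) (Fin K) :=
  (B.cellKernel cell (t + 1)).comap
    (fun p => Fin.snoc (α := fun _ => A × ℝ) p.1.1 (p.1.2, p.2)) (measurable_histSnoc' t)

/-- The updated posterior is a conditional law of the cell given the reward, for almost every
history and action. -/
theorem ae_obsKernel_disintegration (B : BayesianBandit O A) (hcell : Measurable cell) (t : ℕ) :
    ∀ᵐ p ∂(B.histLaw t ⊗ₘ B.actionLaw t),
      (B.obsKernel cell t p).snd ⊗ₘ (B.nextCellKernel cell t).sectR p =
        (B.obsKernel cell t p).map Prod.swap := by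
  have := B.isMarkovKernel_obsKernel hcell t
  have := B.isMarkovKernel_cellKernel hcell (t + 1)
  have : IsMarkovKernel (B.nextCellKernel cell t) := by unfold nextCellKernel; infer_instance
  -- Two finite kernels with the same composition with a measure agree almost everywhere, so it
  -- suffices to compare integrals of test functions.
  have key : (B.histLaw t ⊗ₘ B.actionLaw t) ⊗ₘ
      ((B.obsKernel cell t).snd ⊗ₖ B.nextCellKernel cell t) =
      (B.histLaw t ⊗ₘ B.actionLaw t) ⊗ₘ (B.obsKernel cell t).map Prod.swap := by
    refine Measure.ext_of_lintegral _ fun F hF => ?_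
    -- `dec` undoes the appending of a round, so that a test function of (h, a, r, k) becomes a
    -- function of the longer history and k.
    set dec : Hist A (t + 1) → (Hist A t × A) × ℝ := fun h =>
      ((Fin.init h, (h (Fin.last t)).1), (h (Fin.last t)).2) with hdec
    have hdecm : Measurable dec := by
      refine Measurable.prodMk (Measurable.prodMk (measurable_pi_iff.mpr fun i => ?_) ?_) ?_
      · exact measurable_pi_apply _
      all_goals fun_prop
    have hdecs (h : Hist A t) (a : A) (r : ℝ) :
        dec (Fin.snoc (α := fun _ => A × ℝ) h (a, r)) = ((h, a), r) := by
      simp [hdec]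
    set G : Hist A (t + 1) × Fin K → ℝ≥0∞ := fun q =>
      F ((dec q.1).1, ((dec q.1).2, q.2)) with hG
    have hGm : Measurable G := by fun_prop
    have hGθ : Measurable fun q : O × Hist A (t + 1) => G (q.2, cell (B.optAct q.1)) :=
      hGm.comp (measurable_snd.prodMk (hcell.comp (B.measurable_optAct.comp measurable_fst)))
    have hcm : Measurable fun h => ∫⁻ k, G (h, k) ∂B.cellKernel cell (t + 1) h :=
      hGm.lintegral_kernel_prod_right'
    have hinner : Measurable fun p : (Hist A t × A) × ℝ =>
        ∫⁻ k, F (p.1, (p.2, k)) ∂B.nextCellKernel cell t p := by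
      have : Measurable fun q : ((Hist A t × A) × ℝ) × Fin K => F (q.1.1, (q.1.2, q.2)) := by
        fun_prop
      exact this.lintegral_kernel_prod_right'
    -- The defining property of the posterior after `t + 1` rounds enters here: averaging over it,
    -- given the longer history, restores the true parameter. The remaining side only unfolds the
    -- round.
    have hL : ∫⁻ x, F x ∂((B.histLaw t ⊗ₘ B.actionLaw t) ⊗ₘ
        ((B.obsKernel cell t).snd ⊗ₖ B.nextCellKernel cell t)) =
        ∫⁻ q, G (q.2, cell (B.optAct q.1))
          ∂(B.tsLaw (t + 1) : Measure (O × Hist A (t + 1))) := by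
      rw [lintegral_tsLaw B _ hGθ]
      simp_rw [← fun h => lintegral_cellKernel B hcell (t + 1) h (fun k => G (h, k))]
      rw [lintegral_histLaw B _ hcm, lintegral_tsLaw_succ B t
          (F := fun p => ∫⁻ k, G (p.2, k) ∂B.cellKernel cell (t + 1) p.2)
          (hcm.comp measurable_snd),
        Measure.lintegral_compProd hF,
        Measure.lintegral_compProd hF.lintegral_kernel_prod_right']
      refine lintegral_congr fun h => lintegral_congr fun a => ?_
      have hi : Measurable fun r : ℝ =>
          ∫⁻ k, F ((h, a), (r, k)) ∂B.nextCellKernel cell t ((h, a), r) :=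
        hinner.comp measurable_prodMk_left
      have hFa : Measurable fun x : ℝ × Fin K => F ((h, a), x) := hF.comp measurable_prodMk_left
      rw [Kernel.lintegral_compProd _ _ _ hFa, Kernel.lintegral_snd _ _ hi,
        lintegral_obsKernel B hcell t _ (F := fun x : Fin K × ℝ =>
          ∫⁻ k, F ((h, a), (x.2, k)) ∂B.nextCellKernel cell t ((h, a), x.2))
          (hi.comp measurable_snd)]
      refine lintegral_congr fun θ => lintegral_congr fun r => ?_
      simp only [hG, hdecs]
      rfl
    rw [hL, lintegral_tsLaw_succ B t hGθ, Measure.lintegral_compProd hF,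
        Measure.lintegral_compProd hF.lintegral_kernel_prod_right']
    refine lintegral_congr fun h => lintegral_congr fun a => ?_
    have hFa : Measurable fun x : ℝ × Fin K => F ((h, a), x) := hF.comp measurable_prodMk_left
    rw [Kernel.lintegral_map _ measurable_swap _ hFa,
      lintegral_obsKernel B hcell t _ (F := fun x : Fin K × ℝ => F ((h, a), x.swap))
        (hFa.comp measurable_swap)]
    refine lintegral_congr fun θ => lintegral_congr fun r => ?_
    simp only [hG, hdecs]
    rfl
  have : IsFiniteKernel ((B.obsKernel cell t).map Prod.swap) := inferInstance
  filter_upwards [Kernel.ae_eq_of_compProd_eq key] with p hp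
  rw [← Kernel.map_apply _ measurable_swap, ← hp, Kernel.compProd_apply_eq_compProd_sectR,
    Kernel.snd_apply]
  rfl

end BayesianBandit

/-! ### Telescoping of the expected posterior entropy -/

namespace BayesianBandit

variable {O A : Type*} [MeasurableSpace O] [MeasurableSpace A] [StandardBorelSpace O] [Nonempty O]
  {K : ℕ} {cell : A → Fin K}

/-- The expected entropy of the cell of the optimal action after one more round. -/
noncomputable def nextEntropy (B : BayesianBandit O A) (cell : A → Fin K) (t : ℕ)
    (h : Hist A t) : ℝ≥0∞ :=
  ∫⁻ a, ∫⁻ r, ENNReal.ofReal (finEntropy (B.nextCellKernel cell t ((h, a), r)))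
    ∂(B.obsKernel cell t (h, a)).snd ∂B.actionLaw t h

/-- The expected decrease of the entropy of the cell of the optimal action during a round. -/
noncomputable def infoGain (B : BayesianBandit O A) (cell : A → Fin K) (t : ℕ)
    (h : Hist A t) : ℝ≥0∞ :=
  ENNReal.ofReal (finEntropy (B.cellKernel cell t h)) - B.nextEntropy cell t h

theorem measurable_nextEntropy_integrand (B : BayesianBandit O A) (hcell : Measurable cell)
    (t : ℕ) : Measurable fun p : Hist A t × A =>
      ∫⁻ r, ENNReal.ofReal (finEntropy (B.nextCellKernel cell t (p, r)))
        ∂(B.obsKernel cell t p).snd := by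
  have := B.isMarkovKernel_obsKernel hcell t
  have hm := (measurable_finEntropy (B.nextCellKernel cell t)).ennreal_ofReal
  have := hm.lintegral_kernel_prod_right' (κ := (B.obsKernel cell t).snd)
  simpa only [Kernel.snd_apply, Measure.snd] using this

theorem measurable_nextEntropy (B : BayesianBandit O A) (hcell : Measurable cell) (t : ℕ) :
    Measurable (B.nextEntropy cell t) :=
  (B.measurable_nextEntropy_integrand hcell t).lintegral_kernel_prod_right'

/-- Entropies of kernels on a finite set are measurable, whereas φ, and with it the information
ratio, carries no measurability in the history. This is why information is compared with the entropy
drop before integrating. -/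
theorem measurable_infoGain (B : BayesianBandit O A) (hcell : Measurable cell) (t : ℕ) :
    Measurable (B.infoGain cell t) :=
  (measurable_finEntropy _).ennreal_ofReal.sub (B.measurable_nextEntropy hcell t)

/-- For each fixed action, this is the entropy bound with the updated posterior as disintegration.
The entropy before the reward is the same for all actions, so averaging over the action keeps it.
The additive form avoids truncated subtraction and any measurability of the information in the
action. -/
theorem ae_lintegral_rewardInfo_add_nextEntropy_le (B : BayesianBandit O A)
    (hcell : Measurable cell) (t : ℕ) :
    ∀ᵐ h ∂B.histLaw t, ∫⁻ a, B.rewardInfo cell (B.posterior t h) a ∂B.actionLaw t h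
      + B.nextEntropy cell t h ≤ ENNReal.ofReal (finEntropy (B.cellKernel cell t h)) := by
  have := B.isMarkovKernel_obsKernel hcell t
  have := B.isMarkovKernel_cellKernel hcell (t + 1)
  have : IsMarkovKernel (B.nextCellKernel cell t) := by unfold nextCellKernel; infer_instance
  filter_upwards [Measure.ae_ae_of_ae_compProd (B.ae_obsKernel_disintegration hcell t)] with h hh
  have hm : Measurable fun a =>
      ∫⁻ r, ENNReal.ofReal (finEntropy (B.nextCellKernel cell t ((h, a), r)))
        ∂(B.obsKernel cell t (h, a)).snd :=
    (B.measurable_nextEntropy_integrand hcell t).comp measurable_prodMk_left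
  rw [nextEntropy, ← lintegral_add_right _ hm]
  calc _ ≤ ∫⁻ _, ENNReal.ofReal (finEntropy (B.cellKernel cell t h)) ∂B.actionLaw t h := by
        refine lintegral_mono_ae ?_
        filter_upwards [hh] with a ha
        have := mutualInfo_add_lintegral_finEntropy_le ha
        rwa [fst_obsKernel B hcell, ← rewardInfo_posterior B hcell] at this
    _ = _ := by simp

theorem ae_lintegral_rewardInfo_le_infoGain (B : BayesianBandit O A)
    (hcell : Measurable cell) (t : ℕ) :
    ∀ᵐ h ∂B.histLaw t, ∫⁻ a, B.rewardInfo cell (B.posterior t h) a ∂B.actionLaw t h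
      ≤ B.infoGain cell t h := by
  filter_upwards [B.ae_lintegral_rewardInfo_add_nextEntropy_le hcell t] with h hh
  exact ENNReal.le_sub_of_add_le_right
    ((le_add_self.trans hh).trans_lt ENNReal.ofReal_lt_top).ne hh

/-- Drawing a history, a Thompson action and a reward from its predictive law produces exactly the
next history. -/
theorem lintegral_nextEntropy (B : BayesianBandit O A) (hcell : Measurable cell) (t : ℕ) :
    ∫⁻ h, B.nextEntropy cell t h ∂B.histLaw t =
      ∫⁻ h, ENNReal.ofReal (finEntropy (B.cellKernel cell (t + 1) h)) ∂B.histLaw (t + 1) := by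
  have hm : Measurable fun h => ENNReal.ofReal (finEntropy (B.cellKernel cell (t + 1) h)) :=
    (measurable_finEntropy _).ennreal_ofReal
  rw [lintegral_histLaw B _ hm, lintegral_tsLaw_succ B t
    (F := fun p => ENNReal.ofReal (finEntropy (B.cellKernel cell (t + 1) p.2)))
    (hm.comp measurable_snd)]
  refine lintegral_congr fun h => lintegral_congr fun a => ?_
  have hn : Measurable fun r =>
      ENNReal.ofReal (finEntropy (B.nextCellKernel cell t ((h, a), r))) :=
    (measurable_finEntropy (B.nextCellKernel cell t)).ennreal_ofReal.comp measurable_prodMk_left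
  rw [Measure.snd, lintegral_map hn measurable_snd, lintegral_obsKernel B hcell t _
    (F := fun x => ENNReal.ofReal (finEntropy (B.nextCellKernel cell t ((h, a), x.2))))
    (hn.comp measurable_snd)]
  rfl

theorem lintegral_infoGain_add (B : BayesianBandit O A) (hcell : Measurable cell) (t : ℕ) :
    ∫⁻ h, B.infoGain cell t h ∂B.histLaw t +
      ∫⁻ h, ENNReal.ofReal (finEntropy (B.cellKernel cell (t + 1) h)) ∂B.histLaw (t + 1) =
    ∫⁻ h, ENNReal.ofReal (finEntropy (B.cellKernel cell t h)) ∂B.histLaw t := by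
  rw [← lintegral_nextEntropy B hcell, ← lintegral_add_right _ (B.measurable_nextEntropy hcell t)]
  refine lintegral_congr_ae ?_
  filter_upwards [B.ae_lintegral_rewardInfo_add_nextEntropy_le hcell t] with h hh
  -- The subtraction in `infoGain` is not truncated, by the preceding entropy bound.
  exact tsub_add_cancel_of_le (le_add_self.trans hh)

/-- A round only extends the history and leaves Θ untouched. -/
theorem lintegral_tsLaw_comp_fst (B : BayesianBandit O A) (t : ℕ) {F : O → ℝ≥0∞}
    (hF : Measurable F) :
    ∫⁻ p, F p.1 ∂(B.tsLaw t : Measure (O × Hist A t)) = ∫⁻ θ, F θ ∂B.prior := by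
  induction t with
  | zero => exact lintegral_map (f := fun p : O × Hist A 0 => F p.1) (by fun_prop) (by fun_prop)
  | succ t ih =>
    rw [← ih, lintegral_tsLaw_succ B t (F := fun p => F p.1) (by fun_prop),
      lintegral_tsLaw B t (by fun_prop)]
    simp

theorem map_fst_tsLaw (B : BayesianBandit O A) (t : ℕ) :
    (B.tsLaw t : Measure (O × Hist A t)).map Prod.fst = B.prior :=
  Measure.ext_of_lintegral _ fun _ hF => by
    rw [lintegral_map hF measurable_fst, lintegral_tsLaw_comp_fst B t hF]

theorem cellKernel_zero (B : BayesianBandit O A) (hcell : Measurable cell) (h : Hist A 0) :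
    B.cellKernel cell 0 h = B.prior.map fun θ => cell (B.optAct θ) := by
  have hm : Measurable fun θ => cell (B.optAct θ) := hcell.comp B.measurable_optAct
  refine Measure.ext_of_lintegral _ fun F hF => ?_
  rw [lintegral_map hF hm, lintegral_cellKernel B hcell,
    ← lintegral_tsLaw_comp_fst B 0 (F := fun θ => F (cell (B.optAct θ))) (hF.comp hm),
    lintegral_tsLaw B 0 (F := fun p => F (cell (B.optAct p.1)))
      ((hF.comp hm).comp measurable_fst)]
  -- There is only one empty history, so conditioning on it is trivial and the identity holds
  -- everywhere.
  have (h' : Hist A 0) : h' = h := Subsingleton.elim _ _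
  simp [this]

theorem sum_lintegral_infoGain_add (B : BayesianBandit O A) (hcell : Measurable cell) (T : ℕ) :
    ∑ t ∈ Finset.range T, ∫⁻ h, B.infoGain cell t h ∂B.histLaw t +
      ∫⁻ h, ENNReal.ofReal (finEntropy (B.cellKernel cell T h)) ∂B.histLaw T =
    ENNReal.ofReal (B.entropy cell) := by
  induction T with
  | zero =>
    have hm : Measurable fun θ => cell (B.optAct θ) := hcell.comp B.measurable_optAct
    have : B.entropy cell = finEntropy (B.prior.map fun θ => cell (B.optAct θ)) :=
      Finset.sum_congr rfl fun k _ => by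
        rw [map_measureReal_apply hm (measurableSet_singleton k)]; rfl
    simp [cellKernel_zero B hcell, this]
  | succ T ih =>
    rw [Finset.sum_range_succ, add_assoc, lintegral_infoGain_add B hcell, ih]

end BayesianBandit

/-! ### Convexity of mutual information and finite mixtures -/

/-- Transforming one coordinate carries the product of the marginals to the product of the new
marginals, so data processing for the divergence applies. -/
theorem mutualInfo_map_snd_le {X Y Z : Type*} [MeasurableSpace X] [MeasurableSpace Y]
    [MeasurableSpace Z] (μ : Measure (X × Y)) [IsProbabilityMeasure μ] {g : Y → Z}
    (hg : Measurable g) : mutualInfo (μ.map (Prod.map id g)) ≤ mutualInfo μ := by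
  have hm : Measurable (Prod.map (id : X → X) g) := measurable_id.prodMap hg
  have h : (μ.map (Prod.map id g)).fst.prod (μ.map (Prod.map id g)).snd =
      (μ.fst.prod μ.snd).map (Prod.map id g) := by
    rw [← Measure.map_prod_map _ _ measurable_id hg, Measure.fst, Measure.snd, Measure.fst,
      Measure.snd, Measure.map_map measurable_fst hm, Measure.map_map measurable_snd hm,
      Measure.map_map hg measurable_snd, Measure.map_id]
    rfl
  rw [mutualInfo, h]
  exact klDiv_map_le _ _ hm

theorem map_sum_nnreal_smul {ι X Z : Type*} [Fintype ι] [MeasurableSpace X] [MeasurableSpace Z]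
    (c : ι → NNReal) (μ : ι → Measure X) {f : X → Z} (hf : Measurable f) :
    (∑ i, c i • μ i).map f = ∑ i, c i • (μ i).map f := by
  refine Measure.ext_of_lintegral _ fun F hF => ?_
  rw [lintegral_map hF hf, lintegral_finsetSum_measure, lintegral_finsetSum_measure]
  refine Finset.sum_congr rfl fun i _ => ?_
  rw [lintegral_smul_measure, lintegral_smul_measure, lintegral_map hF hf]

theorem prod_sum_nnreal_smul {ι X Y : Type*} [Fintype ι] [MeasurableSpace X]
    [MeasurableSpace Y] (p : Measure X) [IsFiniteMeasure p] (c : ι → NNReal) (ν : ι → Measure Y)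
    [∀ i, IsFiniteMeasure (ν i)] :
    p.prod (∑ i, c i • ν i) = ∑ i, c i • p.prod (ν i) := by
  refine Measure.ext_of_lintegral _ fun F hF => ?_
  rw [lintegral_prod_symm _ hF.aemeasurable, lintegral_finsetSum_measure,
    lintegral_finsetSum_measure]
  refine Finset.sum_congr rfl fun i _ => ?_
  rw [lintegral_smul_measure, lintegral_smul_measure, lintegral_prod_symm _ hF.aemeasurable]

/-- Mutual information is convex in the conditional law of the second variable. -/
theorem mutualInfo_sum_le {ι X Y : Type*} [Fintype ι] [MeasurableSpace X] [MeasurableSpace Y]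
    (c : ι → NNReal) (hc : ∑ i, c i = 1) (μ : ι → Measure (X × Y))
    [∀ i, IsProbabilityMeasure (μ i)] (p : Measure X) [IsProbabilityMeasure p]
    (hp : ∀ i, (μ i).fst = p) :
    mutualInfo (∑ i, c i • μ i) ≤ ∑ i, c i * mutualInfo (μ i) := by
  have hfst : (∑ i, c i • μ i).fst = p := by
    rw [Measure.fst, map_sum_nnreal_smul c μ measurable_fst]
    change ∑ i, c i • (μ i).fst = p
    simp only [hp, ← Finset.sum_smul, hc, one_smul]
  have hsnd : (∑ i, c i • μ i).snd = ∑ i, c i • (μ i).snd :=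
    map_sum_nnreal_smul c μ measurable_snd
  -- Since the first marginal is common, the product of the marginals of the mixture is the mixture
  -- of the products.
  rw [mutualInfo, hfst, hsnd, prod_sum_nnreal_smul]
  refine (klDiv_sum_le _ _).trans (Finset.sum_le_sum fun i _ => ?_)
  rw [klDiv_smul_same, mutualInfo, hp i]

namespace TwoPoint

variable {A : Type*}

/-- The two points of a random choice. -/
def pt (p : TwoPoint A) : Bool → A
  | true => p.fst
  | false => p.snd

/-- The probabilities of the two points of a random choice. -/
noncomputable def wt (p : TwoPoint A) : Bool → NNReal
  | true => p.q.toNNReal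
  | false => (1 - p.q).toNNReal

theorem sum_wt (p : TwoPoint A) : ∑ b, p.wt b = 1 := by
  simp only [Fintype.sum_bool, wt]
  rw [← Real.toNNReal_add p.q_nonneg (by linarith [p.q_le_one])]
  simp

theorem coe_wt_true (p : TwoPoint A) : (p.wt true : ℝ) = p.q := Real.coe_toNNReal _ p.q_nonneg

theorem coe_wt_false (p : TwoPoint A) : (p.wt false : ℝ) = 1 - p.q :=
  Real.coe_toNNReal _ (by linarith [p.q_le_one])

theorem law_eq_sum [MeasurableSpace A] (p : TwoPoint A) :
    p.law = ∑ b, p.wt b • Measure.dirac (p.pt b) := by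
  simp only [Fintype.sum_bool]; rfl

end TwoPoint

theorem integral_sum_smul_dirac {ι A : Type*} [Fintype ι] [MeasurableSpace A] (c : ι → NNReal)
    (a : ι → A) {f : A → ℝ} (hf : StronglyMeasurable f) :
    ∫ x, f x ∂(∑ i, c i • Measure.dirac (a i)) = ∑ i, c i * f (a i) := by
  rw [integral_finsetSum_measure fun i _ =>
    (integrable_dirac' hf enorm_lt_top).smul_measure_nnreal]
  refine Finset.sum_congr rfl fun i _ => ?_
  rw [integral_smul_nnreal_measure, integral_dirac' _ _ hf]
  rfl

theorem lintegral_sum_smul_dirac {ι A : Type*} [Fintype ι] [MeasurableSpace A] (c : ι → NNReal)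
    (a : ι → A) {f : A → ℝ≥0∞} (hf : Measurable f) :
    ∫⁻ x, f x ∂(∑ i, c i • Measure.dirac (a i)) = ∑ i, c i * f (a i) := by
  rw [lintegral_finsetSum_measure]
  refine Finset.sum_congr rfl fun i _ => ?_
  rw [lintegral_smul_measure, lintegral_dirac' _ hf]
  rfl

/-- Law of total expectation over the cells. It holds for an arbitrary `g`, since only the cells
have to be measurable, and it is used for an information whose measurability is not known. -/
theorem sum_measure_mul_lintegral_cond {A : Type*} [MeasurableSpace A] {K : ℕ} {cell : A → Fin K}
    (hcell : Measurable cell) (α : Measure A) [IsFiniteMeasure α] (g : A → ℝ≥0∞) :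
    ∑ k, α (cell ⁻¹' {k}) * ∫⁻ a, g a ∂α[|cell ⁻¹' {k}] = ∫⁻ a, g a ∂α := by
  have h1 (k : Fin K) : α (cell ⁻¹' {k}) * ∫⁻ a, g a ∂α[|cell ⁻¹' {k}] =
      ∫⁻ a in cell ⁻¹' {k}, g a ∂α := by
    rw [ProbabilityTheory.cond, lintegral_smul_measure, smul_eq_mul, ← mul_assoc]
    by_cases h0 : α (cell ⁻¹' {k}) = 0
    · rw [h0, zero_mul, zero_mul, Measure.restrict_eq_zero.2 h0, lintegral_zero_measure]
    · rw [ENNReal.mul_inv_cancel h0 (measure_ne_top _ _), one_mul]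
  simp only [h1]
  rw [← lintegral_biUnion_finset (fun i _ j _ hij =>
    Disjoint.preimage cell (Set.disjoint_singleton.2 hij))
    (fun k _ => hcell (measurableSet_singleton k))]
  have : (⋃ k ∈ (Finset.univ : Finset (Fin K)), cell ⁻¹' {k}) = Set.univ := by
    ext; simp
  rw [this, Measure.restrict_univ]

theorem sum_measure_mul_integral_cond {A : Type*} [MeasurableSpace A] {K : ℕ} {cell : A → Fin K}
    (hcell : Measurable cell) (α : Measure A) [IsFiniteMeasure α] {g : A → ℝ}
    (hg : Integrable g α) :
    ∑ k, α.real (cell ⁻¹' {k}) * ∫ a, g a ∂α[|cell ⁻¹' {k}] = ∫ a, g a ∂α := by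
  have h1 (k : Fin K) : α.real (cell ⁻¹' {k}) * ∫ a, g a ∂α[|cell ⁻¹' {k}] =
      ∫ a in cell ⁻¹' {k}, g a ∂α := by
    rw [ProbabilityTheory.cond, integral_smul_measure, smul_eq_mul, ← mul_assoc]
    by_cases h0 : α (cell ⁻¹' {k}) = 0
    · rw [measureReal_def, h0, Measure.restrict_eq_zero.2 h0]; simp
    · rw [measureReal_def, ← ENNReal.toReal_mul,
        ENNReal.mul_inv_cancel h0 (measure_ne_top _ _), ENNReal.toReal_one, one_mul]
  simp only [h1]
  rw [← integral_biUnion_finset _ (fun k _ => hcell (measurableSet_singleton k))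
    (fun i _ j _ hij => Disjoint.preimage cell (Set.disjoint_singleton.2 hij))
    (fun _ _ => hg.integrableOn)]
  have : (⋃ k ∈ (Finset.univ : Finset (Fin K)), cell ⁻¹' {k}) = Set.univ := by
    ext; simp
  rw [this, Measure.restrict_univ]

/-! ### Information revealed by an independent random action -/

namespace BayesianBandit

variable {O A : Type*} [MeasurableSpace O] [MeasurableSpace A]
  {K : ℕ} {cell : A → Fin K}

/-- Revealing a random action that is independent of the parameter and takes finitely many values
gives at most the average of the informations of these values. -/
theorem actionRewardInfo_sum_le {ι : Type*} [Fintype ι] (B : BayesianBandit O A)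
    (hcell : Measurable cell) (ρ : Measure O) [IsProbabilityMeasure ρ] (c : ι → NNReal)
    (hc : ∑ i, c i = 1) (a : ι → A) :
    B.actionRewardInfo cell ρ (∑ i, c i • Measure.dirac (a i)) ≤
      ∑ i, c i * B.rewardInfo cell ρ (a i) := by
  have hX : Measurable fun θ => cell (B.optAct θ) := hcell.comp B.measurable_optAct
  have hm : Measurable fun p : O × ℝ => (cell (B.optAct p.1), p.2) :=
    (hX.comp measurable_fst).prodMk measurable_snd
  have hm' : Measurable fun p : (A × O) × ℝ => (cell (B.optAct p.1.2), (p.1.1, p.2)) :=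
    (hX.comp (measurable_snd.comp measurable_fst)).prodMk (by fun_prop)
  set ν : ι → Measure (Fin K × ℝ) := fun i =>
    (ρ ⊗ₘ B.reward.comap (fun θ => (a i, θ)) (by fun_prop)).map
      (fun p : O × ℝ => (cell (B.optAct p.1), p.2)) with hν
  have hνp (i : ι) : IsProbabilityMeasure (ν i) := Measure.isProbabilityMeasure_map hm.aemeasurable
  have hg (i : ι) : Measurable fun r : ℝ => (a i, r) := by fun_prop
  have hgm (i : ι) : Measurable (Prod.map (id : Fin K → Fin K) fun r : ℝ => (a i, r)) :=
    measurable_id.prodMap (hg i)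
  have hint (i : ι) {F : Fin K × ℝ → ℝ≥0∞} (hF : Measurable F) :
      ∫⁻ x, F x ∂ν i = ∫⁻ θ, ∫⁻ r, F (cell (B.optAct θ), r) ∂B.reward (a i, θ) ∂ρ := by
    have hFm : Measurable fun p : O × ℝ => F (cell (B.optAct p.1), p.2) := hF.comp hm
    rw [hν, lintegral_map hF hm, Measure.lintegral_compProd hFm]
    rfl
  -- Decomposition according to the value of the random action: in each component the action is a
  -- constant label attached to the reward.
  have hmix : (((∑ i, c i • Measure.dirac (a i)).prod ρ) ⊗ₘ B.reward).map
      (fun p : (A × O) × ℝ => (cell (B.optAct p.1.2), (p.1.1, p.2))) =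
      ∑ i, c i • (ν i).map (Prod.map id fun r : ℝ => (a i, r)) := by
    refine Measure.ext_of_lintegral _ fun F hF => ?_
    have hFm : Measurable fun p : (A × O) × ℝ => F (cell (B.optAct p.1.2), (p.1.1, p.2)) :=
      hF.comp hm'
    have hFm1 : Measurable fun p : A × O =>
        ∫⁻ r, F (cell (B.optAct p.2), (p.1, r)) ∂B.reward p :=
      hFm.lintegral_kernel_prod_right'
    rw [lintegral_map hF hm', Measure.lintegral_compProd hFm, lintegral_prod _ hFm1.aemeasurable,
      lintegral_sum_smul_dirac _ _ hFm1.lintegral_prod_right', lintegral_finsetSum_measure]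
    refine Finset.sum_congr rfl fun i _ => ?_
    rw [lintegral_smul_measure, lintegral_map hF (hgm i),
      hint i (F := fun x => F (Prod.map id (fun r => (a i, r)) x)) (hF.comp (hgm i))]
    rfl
  -- Independence of the action and Θ: every component has the same law of the cell, as convexity of
  -- mutual information requires.
  have hfst (i : ι) : ((ν i).map (Prod.map id fun r : ℝ => (a i, r))).fst =
      ρ.map fun θ => cell (B.optAct θ) := by
    refine Measure.ext_of_lintegral _ fun F hF => ?_
    have hF1 : Measurable fun x : Fin K × (A × ℝ) => F x.1 := hF.comp measurable_fst
    rw [Measure.fst, lintegral_map hF measurable_fst, lintegral_map hF1 (hgm i),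
      hint i (F := fun x => F (Prod.map id (fun r => (a i, r)) x).1) (hF1.comp (hgm i)),
      lintegral_map hF hX]
    simp
  have hpm (i : ι) : IsProbabilityMeasure ((ν i).map (Prod.map id fun r : ℝ => (a i, r))) :=
    Measure.isProbabilityMeasure_map (hgm i).aemeasurable
  have hXp : IsProbabilityMeasure (ρ.map fun θ => cell (B.optAct θ)) :=
    Measure.isProbabilityMeasure_map hX.aemeasurable
  rw [actionRewardInfo, hmix]
  refine (mutualInfo_sum_le c hc _ _ hfst).trans (Finset.sum_le_sum fun i _ => ?_)
  gcongr
  exact mutualInfo_map_snd_le (ν i) (hg i)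

theorem stronglyMeasurable_mean (B : BayesianBandit O A) :
    StronglyMeasurable fun p : A × O => B.mean p.1 p.2 := by
  have h : StronglyMeasurable fun q : (A × O) × ℝ => q.2 := measurable_snd.stronglyMeasurable
  exact h.integral_kernel_prod_right' (κ := B.reward)

end BayesianBandit

/-! ### Compressed sampling compared with Thompson Sampling -/

namespace BayesianBandit

variable {O A : Type*} [MeasurableSpace O] [MeasurableSpace A] [StandardBorelSpace O] [Nonempty O]
  {K : ℕ} {cell : A → Fin K} {t : ℕ} {φ : Hist A t → Fin K → TwoPoint A}

/-- The posterior probability of a cell. -/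
noncomputable def cellProb (B : BayesianBandit O A) (cell : A → Fin K) (t : ℕ) (h : Hist A t)
    (k : Fin K) : NNReal :=
  (B.posterior t h {θ | cell (B.optAct θ) = k}).toNNReal

theorem coe_cellProb (B : BayesianBandit O A) (h : Hist A t) (k : Fin K) :
    (B.cellProb cell t h k : ℝ≥0∞) = B.posterior t h {θ | cell (B.optAct θ) = k} :=
  ENNReal.coe_toNNReal (measure_ne_top _ _)

theorem actionLaw_preimage_cell (B : BayesianBandit O A) (hcell : Measurable cell)
    (h : Hist A t) (k : Fin K) :
    B.actionLaw t h (cell ⁻¹' {k}) = B.cellProb cell t h k := by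
  rw [coe_cellProb, actionLaw_apply, Measure.map_apply B.measurable_optAct
    (hcell (measurableSet_singleton k))]
  rfl

theorem actionLaw_real_preimage_cell (B : BayesianBandit O A) (hcell : Measurable cell)
    (h : Hist A t) (k : Fin K) :
    (B.actionLaw t h).real (cell ⁻¹' {k}) = B.cellProb cell t h k := by
  rw [measureReal_def, actionLaw_preimage_cell B hcell, ENNReal.coe_toReal]

theorem cellPosterior_eq (B : BayesianBandit O A) (h : Hist A t) (k : Fin K) :
    B.cellPosterior cell t h k = (B.actionLaw t h)[|cell ⁻¹' {k}] := by
  rw [cellPosterior, actionLaw_apply]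

theorem sum_cellProb (B : BayesianBandit O A) (hcell : Measurable cell) (h : Hist A t) :
    ∑ k, B.cellProb cell t h k = 1 := by
  have := sum_measure_mul_lintegral_cond hcell (B.actionLaw t h) fun _ => 1
  have h1 (k : Fin K) : B.actionLaw t h (cell ⁻¹' {k}) *
      ∫⁻ _, 1 ∂(B.actionLaw t h)[|cell ⁻¹' {k}] = B.cellProb cell t h k := by
    rw [actionLaw_preimage_cell B hcell, lintegral_one]
    by_cases h0 : B.cellProb cell t h k = 0
    · simp [h0]
    · have := cond_isProbabilityMeasure (μ := B.actionLaw t h) (s := cell ⁻¹' {k})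
        (by rw [actionLaw_preimage_cell B hcell]; exact_mod_cast h0)
      simp
  simp only [h1] at this
  rw [lintegral_one, measure_univ] at this
  exact_mod_cast this

theorem compressedActionLaw_eq_sum (B : BayesianBandit O A) (hcell : Measurable cell)
    (h : Hist A t) :
    B.compressedActionLaw cell t φ h =
      ∑ i : Fin K × Bool, (B.cellProb cell t h i.1 * (φ h i.1).wt i.2) •
        Measure.dirac ((φ h i.1).pt i.2) := by
  have hX : Measurable fun θ => cell (B.optAct θ) := hcell.comp B.measurable_optAct
  refine Measure.ext_of_lintegral _ fun F hF => ?_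
  rw [compressedActionLaw, Measure.lintegral_bind (measurable_of_countable _).aemeasurable
    hF.aemeasurable, lintegral_fintype, lintegral_sum_smul_dirac _ _ hF, Fintype.sum_prod_type]
  refine Finset.sum_congr rfl fun k _ => ?_
  rw [TwoPoint.law_eq_sum, lintegral_sum_smul_dirac _ _ hF,
    Measure.map_apply hX (measurableSet_singleton k), Finset.sum_mul]
  refine Finset.sum_congr rfl fun b _ => ?_
  have h1 : B.posterior t h ((fun θ => cell (B.optAct θ)) ⁻¹' {k}) = B.cellProb cell t h k :=
    (coe_cellProb B h k).symm
  rw [h1]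
  push_cast
  ring

theorem sum_cellProb_mul_wt (B : BayesianBandit O A) (hcell : Measurable cell) (h : Hist A t) :
    ∑ i : Fin K × Bool, B.cellProb cell t h i.1 * (φ h i.1).wt i.2 = 1 := by
  rw [Fintype.sum_prod_type]
  simp only [← Finset.mul_sum, TwoPoint.sum_wt, mul_one, sum_cellProb B hcell]

/-- The information gathered by compressed Thompson Sampling is at most the one gathered by
Thompson Sampling. -/
theorem ae_actionRewardInfo_le (B : BayesianBandit O A) (hcell : Measurable cell)
    (hφ : B.IsCompressed cell t φ) :
    ∀ᵐ h ∂B.histLaw t, B.actionRewardInfo cell (B.posterior t h) (B.compressedActionLaw cell t φ h)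
      ≤ B.infoGain cell t h := by
  filter_upwards [hφ, B.ae_lintegral_rewardInfo_le_infoGain hcell t] with h hh hle
  refine le_trans ?_ hle
  rw [compressedActionLaw_eq_sum B hcell, ← sum_measure_mul_lintegral_cond hcell]
  refine (B.actionRewardInfo_sum_le hcell _ _ (sum_cellProb_mul_wt B hcell h) _).trans ?_
  rw [Fintype.sum_prod_type]
  refine Finset.sum_le_sum fun k _ => ?_
  rw [actionLaw_preimage_cell B hcell, ← cellPosterior_eq, Fintype.sum_bool]
  -- Nothing is known about φ on cells of posterior probability zero, but they carry no weight.
  by_cases h0 : B.posterior t h {θ | cell (B.optAct θ) = k} = 0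
  · have : B.cellProb cell t h k = 0 := by simp [cellProb, h0]
    simp [this]
  · obtain ⟨-, -, -, -, -, hI⟩ := hh k h0
    refine le_trans (le_of_eq ?_) (mul_le_mul_right hI _)
    simp only [TwoPoint.wt, TwoPoint.pt]
    push_cast
    rw [mul_add, mul_assoc, mul_assoc]
    rfl

/-- The conditional expected regret of a round of Thompson Sampling. -/
noncomputable def stepRegret (B : BayesianBandit O A) (t : ℕ) (h : Hist A t) : ℝ :=
  ∫ θ, B.mean (B.optAct θ) θ ∂B.posterior t h - ∫ a, B.condMean t h a ∂B.actionLaw t h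

omit [StandardBorelSpace O] [Nonempty O] in
theorem stronglyMeasurable_mean_left (B : BayesianBandit O A) (θ : O) :
    StronglyMeasurable fun a => B.mean a θ :=
  B.stronglyMeasurable_mean.comp_measurable measurable_prodMk_right

omit [StandardBorelSpace O] [Nonempty O] in
theorem integral_mean_law (B : BayesianBandit O A) (p : TwoPoint A) (θ : O) :
    ∫ a, B.mean a θ ∂p.law = p.q * B.mean p.fst θ + (1 - p.q) * B.mean p.snd θ := by
  rw [TwoPoint.law_eq_sum, integral_sum_smul_dirac _ _ (B.stronglyMeasurable_mean_left θ),
    Fintype.sum_bool, TwoPoint.coe_wt_true, TwoPoint.coe_wt_false]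
  rfl

theorem ae_posterior_cell_ne_zero (B : BayesianBandit O A) (cell : A → Fin K) (h : Hist A t) :
    ∀ᵐ θ ∂B.posterior t h,
      B.posterior t h {θ' | cell (B.optAct θ') = cell (B.optAct θ)} ≠ 0 := by
  have (k : Fin K) : ∀ᵐ θ ∂B.posterior t h, cell (B.optAct θ) = k →
      B.posterior t h {θ' | cell (B.optAct θ') = k} ≠ 0 := by
    by_cases h0 : B.posterior t h {θ' | cell (B.optAct θ') = k} = 0
    · have : ∀ᵐ θ ∂B.posterior t h, ¬ cell (B.optAct θ) = k := by
        simpa [ae_iff] using h0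
      filter_upwards [this] with θ h1 h2 using absurd h2 h1
    · exact Filter.Eventually.of_forall fun _ _ => h0
  filter_upwards [ae_all_iff.2 this] with θ hθ using hθ _ rfl

/-- Both candidate actions lie in the cell of the optimal action, so each loses at most ε against
it, and so does their convex combination. -/
theorem integral_mean_optAct_le (B : BayesianBandit O A) {ε : ℝ}
    (hcell : B.IsEpsPartition cell ε) (h : Hist A t)
    (hh : ∀ k, B.posterior t h {θ | cell (B.optAct θ) = k} ≠ 0 →
      cell (φ h k).fst = k ∧ cell (φ h k).snd = k ∧
      Integrable (fun θ => B.mean (φ h k).fst θ) (B.posterior t h) ∧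
      Integrable (fun θ => B.mean (φ h k).snd θ) (B.posterior t h))
    (hopt : Integrable (fun θ => B.mean (B.optAct θ) θ) (B.posterior t h)) :
    ∫ θ, B.mean (B.optAct θ) θ ∂B.posterior t h ≤
      ∫ θ, ∫ a, B.mean a θ ∂(φ h (cell (B.optAct θ))).law ∂B.posterior t h + ε := by
  have hX : Measurable fun θ => cell (B.optAct θ) := hcell.1.comp B.measurable_optAct
  simp only [integral_mean_law]
  set V : Fin K → O → ℝ := fun k θ =>
    (φ h k).q * B.mean (φ h k).fst θ + (1 - (φ h k).q) * B.mean (φ h k).snd θ with hV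
  -- As a function of θ the integrand is pieced together from finitely many integrable functions,
  -- one for each non-null cell.
  have hVint : Integrable (fun θ => V (cell (B.optAct θ)) θ) (B.posterior t h) := by
    have h1 : (fun θ => V (cell (B.optAct θ)) θ) = fun θ => ∑ k,
        {θ' | cell (B.optAct θ') = k}.indicator (V k) θ := by
      ext θ
      rw [Finset.sum_eq_single (cell (B.optAct θ))]
      · simp
      · intro k _ hk
        exact Set.indicator_of_notMem (fun h' => hk h'.symm) _
      · simp
    rw [h1]
    refine integrable_finsetSum _ fun k _ => ?_
    have hms : MeasurableSet {θ' | cell (B.optAct θ') = k} := hX (measurableSet_singleton k)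
    rw [integrable_indicator_iff hms]
    by_cases h0 : B.posterior t h {θ | cell (B.optAct θ) = k} = 0
    · rw [IntegrableOn, Measure.restrict_eq_zero.2 h0]
      exact integrable_zero_measure
    · obtain ⟨-, -, h2, h3⟩ := hh k h0
      exact ((h2.const_mul _).add (h3.const_mul _)).integrableOn
  have hle : ∫ θ, (B.mean (B.optAct θ) θ - ε) ∂B.posterior t h ≤
      ∫ θ, V (cell (B.optAct θ)) θ ∂B.posterior t h := by
    refine integral_mono_ae (hopt.sub (integrable_const ε)) hVint ?_
    filter_upwards [B.ae_posterior_cell_ne_zero cell h] with θ hθ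
    obtain ⟨h1, h2, -, -⟩ := hh _ hθ
    have h3 := hcell.2 θ _ h1
    have h4 := hcell.2 θ _ h2
    have h5 := (φ h (cell (B.optAct θ))).q_nonneg
    have h6 := (φ h (cell (B.optAct θ))).q_le_one
    simp only [hV]
    nlinarith
  rw [integral_sub hopt (integrable_const ε)] at hle
  simp only [integral_const, probReal_univ, one_smul] at hle
  linarith

/-- Because the compressed action is independent of Θ given the history, its mean reward is a
weighted sum of conditional means; the defining inequality of φ is then averaged over the cells. -/
theorem integral_mean_compressedActionLaw_le (B : BayesianBandit O A) (hcell : Measurable cell)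
    (h : Hist A t)
    (hh : ∀ k, B.posterior t h {θ | cell (B.optAct θ) = k} ≠ 0 →
      Integrable (fun θ => B.mean (φ h k).fst θ) (B.posterior t h) ∧
      Integrable (fun θ => B.mean (φ h k).snd θ) (B.posterior t h) ∧
      (φ h k).q * B.condMean t h (φ h k).fst + (1 - (φ h k).q) * B.condMean t h (φ h k).snd
        ≤ ∫ a, B.condMean t h a ∂B.cellPosterior cell t h k)
    (hmean : Integrable (B.condMean t h) (B.actionLaw t h)) :
    ∫ θ, ∫ a, B.mean a θ ∂B.compressedActionLaw cell t φ h ∂B.posterior t h ≤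
      ∫ a, B.condMean t h a ∂B.actionLaw t h := by
  have h0 (k : Fin K) (hk : B.posterior t h {θ | cell (B.optAct θ) = k} = 0) :
      B.cellProb cell t h k = 0 := by simp [cellProb, hk]
  simp only [compressedActionLaw_eq_sum B hcell,
    integral_sum_smul_dirac _ _ (B.stronglyMeasurable_mean_left _)]
  rw [integral_finsetSum, Fintype.sum_prod_type, ← sum_measure_mul_integral_cond hcell _ hmean]
  · refine Finset.sum_le_sum fun k _ => ?_
    rw [actionLaw_real_preimage_cell B hcell, ← cellPosterior_eq, Fintype.sum_bool]
    by_cases hk : B.posterior t h {θ | cell (B.optAct θ) = k} = 0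
    · simp [h0 k hk]
    · obtain ⟨-, -, h3⟩ := hh k hk
      refine le_trans (le_of_eq ?_) (mul_le_mul_of_nonneg_left h3 NNReal.zero_le_coe)
      rw [integral_const_mul, integral_const_mul]
      push_cast
      rw [TwoPoint.coe_wt_true, TwoPoint.coe_wt_false, mul_add, mul_assoc, mul_assoc]
      rfl
  · rintro ⟨k, b⟩ -
    by_cases hk : B.posterior t h {θ | cell (B.optAct θ) = k} = 0
    · simp [h0 k hk]
    · obtain ⟨h1, h2, -⟩ := hh k hk
      cases b
      · exact h2.const_mul _
      · exact h1.const_mul _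

/-- Compression lowers the benchmark by at most ε and does not raise the reward of the played
action. -/
theorem ae_stepRegret_le (B : BayesianBandit O A) {ε : ℝ}
    (hcell : B.IsEpsPartition cell ε) (hφ : B.IsCompressed cell t φ)
    (hopt : ∀ᵐ h ∂B.histLaw t, Integrable (fun θ => B.mean (B.optAct θ) θ) (B.posterior t h))
    (hmean : ∀ᵐ h ∂B.histLaw t, Integrable (B.condMean t h) (B.actionLaw t h)) :
    ∀ᵐ h ∂B.histLaw t, B.stepRegret t h ≤ B.compressedRegret cell t φ h + ε := by
  filter_upwards [hφ, hopt, hmean] with h h1 h2 h3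
  have h4 := B.integral_mean_optAct_le (φ := φ) hcell h (fun k hk =>
    ⟨(h1 k hk).1, (h1 k hk).2.1, (h1 k hk).2.2.1, (h1 k hk).2.2.2.1⟩) h2
  have h5 := B.integral_mean_compressedActionLaw_le (φ := φ) hcell.1 h (fun k hk =>
    ⟨(h1 k hk).2.2.1, (h1 k hk).2.2.2.1, (h1 k hk).2.2.2.2.1⟩) h3
  rw [stepRegret, compressedRegret]
  linarith

end BayesianBandit

/-! ### Integrability and the regret as a sum over rounds -/

theorem integrable_integral_compProd {α β : Type*} [MeasurableSpace α] [MeasurableSpace β]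
    {μ : Measure α} [SFinite μ] {κ : Kernel α β} [IsSFiniteKernel κ] {f : α × β → ℝ}
    (hf : Integrable f (μ ⊗ₘ κ)) : Integrable (fun x => ∫ y, f (x, y) ∂κ x) μ := by
  have h := (Measure.integrable_compProd_iff hf.1).1 hf
  exact Integrable.mono h.2 (AEStronglyMeasurable.integral_kernel_compProd (a := ()) hf.1) <|
    Filter.Eventually.of_forall fun x => by
      rw [Real.norm_of_nonneg (integral_nonneg fun _ => norm_nonneg _)]
      exact norm_integral_le_integral_norm _

namespace BayesianBandit

variable {O A : Type*} [MeasurableSpace O] [MeasurableSpace A] [StandardBorelSpace O] [Nonempty O]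

/-- The joint law of the history, of the action selected by Thompson Sampling and of the
parameter. -/
noncomputable def playLaw (B : BayesianBandit O A) (t : ℕ) : Measure (Hist A t × (A × O)) :=
  B.histLaw t ⊗ₘ (B.actionLaw t ×ₖ B.posterior t)

/-- Later rounds change neither Θ nor an action already played, so the pair keeps the law it had in
its own round, where both are independent draws from the posterior. -/
theorem lintegral_tsLaw_action (B : BayesianBandit O A) {F : A × O → ℝ≥0∞} (hF : Measurable F)
    (T : ℕ) (i : Fin T) :
    ∫⁻ p, F ((p.2 i).1, p.1) ∂(B.tsLaw T : Measure (O × Hist A T)) =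
      ∫⁻ h, ∫⁻ a, ∫⁻ θ, F (a, θ) ∂B.posterior i h ∂B.actionLaw i h ∂B.histLaw i := by
  induction T with
  | zero => exact i.elim0
  | succ T ih =>
    rw [lintegral_tsLaw_succ B T (F := fun p => F ((p.2 i).1, p.1)) (by fun_prop)]
    refine Fin.lastCases ?_ (fun j => ?_) i
    · simp
    · have h1 := ih j
      rw [lintegral_tsLaw B T (F := fun p => F ((p.2 j).1, p.1)) (by fun_prop)] at h1
      simpa using h1

theorem map_action_tsLaw (B : BayesianBandit O A) (T : ℕ) (i : Fin T) :
    (B.tsLaw T : Measure (O × Hist A T)).map (fun p => ((p.2 i).1, p.1)) =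
      (B.playLaw i).map Prod.snd := by
  refine Measure.ext_of_lintegral _ fun F hF => ?_
  rw [lintegral_map hF (by fun_prop), lintegral_tsLaw_action B hF, lintegral_map hF measurable_snd,
    playLaw, Measure.lintegral_compProd (f := fun p => F p.2) (hF.comp measurable_snd)]
  refine lintegral_congr fun h => ?_
  rw [Kernel.prod_apply, lintegral_prod _ (by fun_prop)]

theorem map_snd_compProd_posterior (B : BayesianBandit O A) (t : ℕ) :
    (B.histLaw t ⊗ₘ B.posterior t).map Prod.snd = B.prior := by
  rw [← map_swap_tsLaw, Measure.map_map measurable_snd measurable_swap, ← map_fst_tsLaw B t]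
  rfl

omit [StandardBorelSpace O] [Nonempty O] in
theorem stronglyMeasurable_mean_optAct (B : BayesianBandit O A) :
    StronglyMeasurable fun θ => B.mean (B.optAct θ) θ :=
  B.stronglyMeasurable_mean.comp_measurable (B.measurable_optAct.prodMk measurable_id)

section Integrable

variable {B : BayesianBandit O A} {T : ℕ}

theorem IntegrableRewards.integrable_optAct (hB : B.IntegrableRewards T) (t : ℕ) :
    Integrable (fun p : Hist A t × O => B.mean (B.optAct p.2) p.2)
      (B.histLaw t ⊗ₘ B.posterior t) := by
  have h := hB.1
  rw [← map_snd_compProd_posterior B t] at h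
  exact h.comp_measurable measurable_snd

theorem IntegrableRewards.integrable_playLaw (hB : B.IntegrableRewards T) (t : Fin T) :
    Integrable (fun p : Hist A t × (A × O) => B.mean p.2.1 p.2.2) (B.playLaw t) := by
  have h : Integrable (fun p : A × O => B.mean p.1 p.2) ((B.playLaw t).map Prod.snd) := by
    rw [← map_action_tsLaw, integrable_map_measure
      B.stronglyMeasurable_mean.aestronglyMeasurable (by fun_prop)]
    exact hB.2 t
  exact h.comp_measurable measurable_snd

theorem IntegrableRewards.ae_integrable_optAct (hB : B.IntegrableRewards T) (t : ℕ) :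
    ∀ᵐ h ∂B.histLaw t, Integrable (fun θ => B.mean (B.optAct θ) θ) (B.posterior t h) :=
  ((Measure.integrable_compProd_iff (hB.integrable_optAct t).1).1 (hB.integrable_optAct t)).1

theorem IntegrableRewards.ae_integrable_prod (hB : B.IntegrableRewards T) (t : Fin T) :
    ∀ᵐ h ∂B.histLaw t, Integrable (fun p : A × O => B.mean p.1 p.2)
      ((B.actionLaw t h).prod (B.posterior t h)) := by
  have := ((Measure.integrable_compProd_iff (hB.integrable_playLaw t).1).1
    (hB.integrable_playLaw t)).1
  simpa only [Kernel.prod_apply] using this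

theorem IntegrableRewards.ae_integrable_condMean (hB : B.IntegrableRewards T) (t : Fin T) :
    ∀ᵐ h ∂B.histLaw t, Integrable (B.condMean t h) (B.actionLaw t h) := by
  filter_upwards [hB.ae_integrable_prod t] with h hh using hh.integral_prod_left

theorem IntegrableRewards.ae_integral_prod_eq (hB : B.IntegrableRewards T) (t : Fin T) :
    ∀ᵐ h ∂B.histLaw t, ∫ p, B.mean p.1 p.2 ∂(B.actionLaw t ×ₖ B.posterior t) h =
      ∫ a, B.condMean t h a ∂B.actionLaw t h := by
  filter_upwards [hB.ae_integrable_prod t] with h hh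
  rw [Kernel.prod_apply, integral_prod _ hh]
  rfl

theorem IntegrableRewards.integrable_integral_condMean (hB : B.IntegrableRewards T) (t : Fin T) :
    Integrable (fun h => ∫ a, B.condMean t h a ∂B.actionLaw t h) (B.histLaw t) :=
  Integrable.congr (integrable_integral_compProd (hB.integrable_playLaw t))
    (hB.ae_integral_prod_eq t)

theorem IntegrableRewards.integrable_stepRegret (hB : B.IntegrableRewards T) (t : Fin T) :
    Integrable (B.stepRegret t) (B.histLaw t) :=
  Integrable.sub (integrable_integral_compProd (hB.integrable_optAct t))
    (hB.integrable_integral_condMean t)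

theorem IntegrableRewards.integral_optAct_sub (hB : B.IntegrableRewards T) (t : Fin T) :
    ∫ p : O × Hist A T, (B.mean (B.optAct p.1) p.1 - B.mean (p.2 t).1 p.1)
      ∂(B.tsLaw T : Measure (O × Hist A T)) = ∫ h, B.stepRegret t h ∂B.histLaw t := by
  have h1 : Integrable (fun p : O × Hist A T => B.mean (B.optAct p.1) p.1)
      (B.tsLaw T : Measure (O × Hist A T)) := by
    have h := hB.1
    rw [← map_fst_tsLaw B T] at h
    exact h.comp_measurable measurable_fst
  have h2 : ∫ p : O × Hist A T, B.mean (B.optAct p.1) p.1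
      ∂(B.tsLaw T : Measure (O × Hist A T)) =
      ∫ h, ∫ θ, B.mean (B.optAct θ) θ ∂B.posterior t h ∂B.histLaw t := by
    rw [← Measure.integral_compProd (hB.integrable_optAct t),
      ← integral_map (φ := Prod.snd) (f := fun θ => B.mean (B.optAct θ) θ) (by fun_prop)
        B.stronglyMeasurable_mean_optAct.aestronglyMeasurable, map_snd_compProd_posterior,
      ← map_fst_tsLaw B T, integral_map (by fun_prop)
        B.stronglyMeasurable_mean_optAct.aestronglyMeasurable]
  have h3 : ∫ p : O × Hist A T, B.mean (p.2 t).1 p.1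
      ∂(B.tsLaw T : Measure (O × Hist A T)) =
      ∫ h, ∫ a, B.condMean t h a ∂B.actionLaw t h ∂B.histLaw t := by
    rw [← integral_congr_ae (hB.ae_integral_prod_eq t),
      ← Measure.integral_compProd (f := fun p : Hist A t × (A × O) => B.mean p.2.1 p.2.2)
        (hB.integrable_playLaw t), ← playLaw,
      ← integral_map (φ := Prod.snd) (f := fun p : A × O => B.mean p.1 p.2) (by fun_prop)
        B.stronglyMeasurable_mean.aestronglyMeasurable, ← map_action_tsLaw,
      integral_map (by fun_prop) B.stronglyMeasurable_mean.aestronglyMeasurable]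
  rw [integral_sub h1 (hB.2 t), h2, h3, ← integral_sub
    (integrable_integral_compProd (hB.integrable_optAct t))
    (hB.integrable_integral_condMean t)]
  rfl

theorem IntegrableRewards.regret_eq_sum (hB : B.IntegrableRewards T) :
    B.regret T = ∑ t ∈ Finset.range T, ∫ h, B.stepRegret t h ∂B.histLaw t := by
  have h1 : Integrable (fun p : O × Hist A T => B.mean (B.optAct p.1) p.1)
      (B.tsLaw T : Measure (O × Hist A T)) := by
    have h := hB.1
    rw [← map_fst_tsLaw B T] at h
    exact h.comp_measurable measurable_fst
  have h2 (t : Fin T) : Integrable (fun p : O × Hist A T =>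
      B.mean (B.optAct p.1) p.1 - B.mean (p.2 t).1 p.1)
      (B.tsLaw T : Measure (O × Hist A T)) := h1.sub (hB.2 t)
  rw [regret, integral_finsetSum _ fun t _ => h2 t,
    ← Fin.sum_univ_eq_sum_range fun t => ∫ h, B.stepRegret t h ∂B.histLaw t]
  exact Finset.sum_congr rfl fun t _ => hB.integral_optAct_sub t

end Integrable

end BayesianBandit

/-! ### From information ratios to the regret bound -/

/-- For finite positive values this is (cx - d)² ≥ 0 divided by cd. At d = 0 with x > 0, or at d =
∞, the right side is infinite, consistent with the conventions for the information ratio. -/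
theorem ENNReal.two_mul_ofReal_le_mul_div_add (x : ℝ) {c d : ℝ≥0∞} (hc0 : c ≠ 0) (hc : c ≠ ∞) :
    2 * ENNReal.ofReal x ≤ c * (ENNReal.ofReal (x ^ 2) / d) + c⁻¹ * d := by
  rcases le_or_gt x 0 with hx | hx
  · simp [ENNReal.ofReal_of_nonpos hx]
  have hx2 : ENNReal.ofReal (x ^ 2) ≠ 0 := by simpa using by positivity
  by_cases hd0 : d = 0
  · simp [hd0, ENNReal.div_zero hx2, ENNReal.mul_top hc0]
  by_cases hd : d = ∞
  · rw [hd, ENNReal.mul_top (ENNReal.inv_ne_zero.2 hc)]; simp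
  lift c to NNReal using hc
  lift d to NNReal using hd
  have hc0' : 0 < c := pos_iff_ne_zero.2 (by exact_mod_cast hc0)
  have hd0' : 0 < d := pos_iff_ne_zero.2 (by exact_mod_cast hd0)
  lift x to NNReal using hx.le
  rw [← NNReal.coe_pow, ENNReal.ofReal_coe_nnreal, ENNReal.ofReal_coe_nnreal,
    ← ENNReal.coe_div hd0'.ne', ← ENNReal.coe_inv hc0'.ne']
  norm_cast
  rw [← NNReal.coe_le_coe]
  push_cast
  have hc1 : (0 : ℝ) < c := hc0'
  have hd1 : (0 : ℝ) < d := hd0'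
  have : (c : ℝ) * ((x : ℝ) ^ 2 / d) + (c : ℝ)⁻¹ * d - 2 * x = (c * x - d) ^ 2 / (c * d) := by
    field_simp
    ring
  have h2 : (0 : ℝ) ≤ (c * x - d) ^ 2 / (c * d) := by positivity
  linarith

theorem ofReal_integral_le_lintegral_ofReal {α : Type*} [MeasurableSpace α] {μ : Measure α}
    {f : α → ℝ} (hf : Integrable f μ) :
    ENNReal.ofReal (∫ x, f x ∂μ) ≤ ∫⁻ x, ENNReal.ofReal (f x) ∂μ := by
  have h := ofReal_integral_eq_lintegral_ofReal hf.pos_part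
    (Filter.Eventually.of_forall fun _ => le_max_right _ _)
  calc ENNReal.ofReal (∫ x, f x ∂μ) ≤ ENNReal.ofReal (∫ x, max (f x) 0 ∂μ) :=
        ENNReal.ofReal_le_ofReal (integral_mono hf hf.pos_part fun _ => le_max_left _ _)
    _ = _ := by rw [h]; simp

theorem le_sqrt_mul_of_forall_two_mul_le {s a b : ℝ} (ha : 0 < a) (hb : 0 ≤ b)
    (h : ∀ c : ℝ, 0 < c → 2 * s ≤ c * a + c⁻¹ * b) : s ≤ √(a * b) := by
  rcases hb.eq_or_lt with rfl | hb
  · rw [mul_zero, Real.sqrt_zero]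
    by_contra! hs
    -- For b = 0 the infimum over c is not attained; this c yields 2s ≤ s, which contradicts s > 0.
    have := h (s / a) (by positivity)
    rw [div_mul_cancel₀ _ ha.ne'] at this
    linarith
  -- This c makes the two terms equal and minimizes their sum.
  · have h1 := h (√(a * b) / a) (by positivity)
    have h2 : √(a * b) ^ 2 = a * b := Real.sq_sqrt (by positivity)
    have h3 : 0 < √(a * b) := by positivity
    have h4 : (√(a * b) / a)⁻¹ * b = √(a * b) := by
      rw [inv_div, div_mul_eq_mul_div, div_eq_iff h3.ne', ← sq, h2]
    rw [div_mul_cancel₀ _ ha.ne', h4] at h1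
    linarith

namespace BayesianBandit

variable {O A : Type*} [MeasurableSpace O] [MeasurableSpace A] [StandardBorelSpace O] [Nonempty O]
  {K : ℕ} {cell : A → Fin K}

omit [StandardBorelSpace O] [Nonempty O] in
theorem entropy_nonneg (B : BayesianBandit O A) (cell : A → Fin K) : 0 ≤ B.entropy cell :=
  Finset.sum_nonneg fun _ _ => Real.negMulLog_nonneg measureReal_nonneg measureReal_le_one

theorem two_mul_lintegral_stepRegret_le (B : BayesianBandit O A) {T : ℕ}
    (hB : B.IntegrableRewards T) {ε : ℝ} (hcell : B.IsEpsPartition cell ε) (t : Fin T)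
    {φ : Hist A t → Fin K → TwoPoint A} (hφ : B.IsCompressed cell t φ) {c : ℝ≥0∞} (hc0 : c ≠ 0)
    (hc : c ≠ ∞) :
    2 * ∫⁻ h, ENNReal.ofReal (B.stepRegret t h - ε) ∂B.histLaw t ≤
      c * ∫⁻ h, B.infoRatio cell t φ h ∂B.histLaw t +
        c⁻¹ * ∫⁻ h, B.infoGain cell t h ∂B.histLaw t := by
  -- Finite constants move inside the integral for any function, and the sum splits because one
  -- summand, the entropy drop, is measurable.
  rw [← lintegral_const_mul' _ _ (by simp), ← lintegral_const_mul' _ _ hc,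
    ← lintegral_const_mul' _ _ (ENNReal.inv_ne_top.2 hc0),
    ← lintegral_add_right _ ((B.measurable_infoGain hcell.1 t).const_mul _)]
  refine lintegral_mono_ae ?_
  filter_upwards [B.ae_stepRegret_le hcell hφ (hB.ae_integrable_optAct t)
    (hB.ae_integrable_condMean t), B.ae_actionRewardInfo_le hcell.1 hφ] with h h1 h2
  calc 2 * ENNReal.ofReal (B.stepRegret t h - ε)
      ≤ 2 * ENNReal.ofReal (B.compressedRegret cell t φ h) := by
        gcongr; linarith
    _ ≤ c * B.infoRatio cell t φ h + c⁻¹ * B.actionRewardInfo cell (B.posterior t h)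
          (B.compressedActionLaw cell t φ h) := ENNReal.two_mul_ofReal_le_mul_div_add _ hc0 hc
    _ ≤ _ := by gcongr

/-- Using the same c in all rounds lets the ratios and the entropy drops be summed separately, so
that only their totals matter. -/
theorem two_mul_regret_sub_le (B : BayesianBandit O A) {T : ℕ} (hB : B.IntegrableRewards T)
    {ε : ℝ} (hcell : B.IsEpsPartition cell ε) {φ : (t : ℕ) → Hist A t → Fin K → TwoPoint A}
    (hφ : ∀ t < T, B.IsCompressed cell t (φ t)) {Γ : ℝ} (hΓ : 0 ≤ Γ)
    (hratio : ∑ t ∈ Finset.range T, ∫⁻ h, B.infoRatio cell t (φ t) h ∂B.histLaw t ≤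
      ENNReal.ofReal Γ) {c : ℝ} (hc : 0 < c) :
    2 * (B.regret T - ε * T) ≤ c * Γ + c⁻¹ * B.entropy cell := by
  have hc0 : ENNReal.ofReal c ≠ 0 := by simpa using hc
  have hbound : 2 * ∑ t ∈ Finset.range T,
      ∫⁻ h, ENNReal.ofReal (B.stepRegret t h - ε) ∂B.histLaw t ≤
      ENNReal.ofReal (c * Γ + c⁻¹ * B.entropy cell) := by
    calc _ ≤ ENNReal.ofReal c *
          ∑ t ∈ Finset.range T, ∫⁻ h, B.infoRatio cell t (φ t) h ∂B.histLaw t +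
          (ENNReal.ofReal c)⁻¹ *
            ∑ t ∈ Finset.range T, ∫⁻ h, B.infoGain cell t h ∂B.histLaw t := by
          rw [Finset.mul_sum, Finset.mul_sum, Finset.mul_sum, ← Finset.sum_add_distrib]
          refine Finset.sum_le_sum fun t ht => ?_
          have ht' := Finset.mem_range.1 ht
          exact B.two_mul_lintegral_stepRegret_le hB hcell ⟨t, ht'⟩ (hφ t ht') hc0
            ENNReal.ofReal_ne_top
      _ ≤ ENNReal.ofReal c * ENNReal.ofReal Γ +
          (ENNReal.ofReal c)⁻¹ * ENNReal.ofReal (B.entropy cell) := by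
          gcongr
          -- The entropy left after `T` rounds is discarded.
          exact le_self_add.trans (B.sum_lintegral_infoGain_add hcell.1 T).le
      _ = _ := by
          have hH := B.entropy_nonneg cell
          rw [← ENNReal.ofReal_inv_of_pos hc, ← ENNReal.ofReal_mul hc.le,
            ← ENNReal.ofReal_mul (by positivity), ← ENNReal.ofReal_add (by positivity)
            (by positivity)]
  have hreg : B.regret T - ε * T =
      ∑ t ∈ Finset.range T, ∫ h, (B.stepRegret t h - ε) ∂B.histLaw t := by
    have (t : ℕ) (ht : t ∈ Finset.range T) : ∫ h, (B.stepRegret t h - ε) ∂B.histLaw t =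
        ∫ h, B.stepRegret t h ∂B.histLaw t - ε := by
      rw [integral_sub (hB.integrable_stepRegret ⟨t, Finset.mem_range.1 ht⟩)
        (integrable_const ε)]
      simp
    rw [Finset.sum_congr rfl this, Finset.sum_sub_distrib, hB.regret_eq_sum]
    simp [mul_comm]
  rw [hreg]
  have hH := B.entropy_nonneg cell
  refine (ENNReal.ofReal_le_ofReal_iff (by positivity)).1 (le_trans ?_ hbound)
  rw [ENNReal.ofReal_mul zero_le_two, ENNReal.ofReal_ofNat]
  gcongr
  refine (Finset.le_sum_of_subadditive ENNReal.ofReal ENNReal.ofReal_zero.le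
    (fun _ _ => ENNReal.ofReal_add_le) _ _).trans (Finset.sum_le_sum fun t ht => ?_)
  exact ofReal_integral_le_lintegral_ofReal
    ((hB.integrable_stepRegret ⟨t, Finset.mem_range.1 ht⟩).sub (integrable_const ε))

end BayesianBandit

theorem mainTheorem1 {O A : Type*} [MeasurableSpace O] [StandardBorelSpace O] [Nonempty O]
    [MeasurableSpace A] (B : BayesianBandit O A) (T : ℕ) (hB : B.IntegrableRewards T)
    (K : ℕ) (cell : A → Fin K) (ε : ℝ) (hcell : B.IsEpsPartition cell ε)
    (φ : (t : ℕ) → Hist A t → Fin K → TwoPoint A)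
    (hφ : ∀ t < T, B.IsCompressed cell t (φ t))
    (Γ : ℝ) (hΓ : 0 < Γ)
    (hratio : (∑ t ∈ Finset.range T, ∫⁻ h, B.infoRatio cell t (φ t) h ∂B.histLaw t) / (T : ℝ≥0∞)
      ≤ ENNReal.ofReal Γ) :
    B.regret T ≤ √(Γ * T * B.entropy cell) + ε * T := by
  -- Dividing by `T` is meaningful only for positive `T`; without rounds there is no regret.
  rcases Nat.eq_zero_or_pos T with rfl | hT
  · simp [BayesianBandit.regret]
  have hT' : (0 : ℝ) < T := Nat.cast_pos.2 hT
  rw [ENNReal.div_le_iff (by exact_mod_cast hT.ne') (ENNReal.natCast_ne_top T),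
    ← ENNReal.ofReal_natCast, ← ENNReal.ofReal_mul hΓ.le] at hratio
  have := le_sqrt_mul_of_forall_two_mul_le (mul_pos hΓ hT') (B.entropy_nonneg cell)
    fun c hc => B.two_mul_regret_sub_le hB hcell hφ (by positivity) hratio hc
  linarith
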